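/- Let $\lambda>0$, $\alpha>2$, $d_0\ge 0$, $P_t>0$, $\theta>0$, $\sigma^2,\sigma_C^2\ge 0$, $0<v\le 1$, and put $\tau=1+d_0^\alpha$. **Network.** A receiver at the origin of $\mathbb R^2$ has its own transmitter $x_0$ at distance $d_0$. The interferers $x_1,x_2,\dots$, numbered by increasing distance $d_i=\|x_i\|$ from the origin, form a homogeneous Poisson point process of density $\lambda$. The fading powers $h_0,h_1,\dots$ are i.i.d. exponential with mean $1$ and independent of all positions. The interference after removal of the $j$ nearest interferers is $I_j=\sum_{i>j}h_i(1+d_i^\alpha)^{-1}$ (the sum is finite almost surely). The useful signal is decoded after $j$ cancellations, $j\ge0$, if $$C_j:\quad \frac{vP_t\,h_0\tau^{-1}}{v(\sigma^2+P_tI_j)+\sigma_C^2}\ge\theta ,$$ and the $j$-th interferer, $j\ge1$, is decoded if $$D_j:\quad \frac{vP_t\,h_j(1+d_j^\alpha)^{-1}}{v(\sigma^2+P_t(I_j+h_0\tau^{-1}))+\sigma_C^2}\ge\theta .$$ **Single attempts.** Let $f(r,n)=\frac{2(\pi\lambda)^n}{\Gamma(n)}r^{2n-1}e^{-\pi\lambda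 r^2}$ be the density of the distance to the $n$-th nearest interferer, let $\xi=1+r^\alpha$, and $$G(s,r)=\exp\Big(-\frac{2\pi\lambda s\,r^{2-\alpha}}{\alpha-2}\,{}_2F_1\big(1,1-\tfrac2\alpha;2-\tfrac2\alpha;-\tfrac{1+s}{r^\alpha}\big)\Big),$$ where ${}_2F_1$ is the (analytically continued) Gauss hypergeometric function. Then $\mathbb P(C_n)=\Pi_C(v,n)$ for $n\ge 0$ and $\mathbb P(D_n)=\Pi_D(v,n)$ for $n\ge1$, where $$\Pi_C(v,0)=\Pi_{NC}(v)=\exp\Big(-\frac{\theta\tau}{P_t}\big(\sigma^2+\tfrac{\sigma_C^2}{v}\big)\Big)\exp\Big(-\frac{2\pi^2\lambda}{\alpha}\theta\tau(1+\theta\tau)^{\frac2\alpha-1}\csc\frac{2\pi}{\alpha}\Big),$$ and for $n\ge1$ $$\Pi_C(v,n)=\exp\Big(-\frac{\theta\tau}{P_t}\big(\sigma^2+\tfrac{\sigma_C^2}{v}\big)\Big)\int_0^\infty f(r,n)\,G(\theta\tau,r)\,dr,$$ $$\Pi_D(v,n)=\int_0^\infty\frac{f(r,n)}{1+\theta\xi\tau^{-1}}\exp\Big(-\frac{\theta\xi}{P_t}\big(\sigma^2+\tfrac{\sigma_C^2}{v}\big)\Big)G(\theta\xi,r)\,dr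 .$$ **Successive interference cancellation (SIC).** The receiver first tries to decode the useful signal; as long as this fails and fewer than $n$ interferers have been cancelled, it decodes and removes the next interferer and tries again. Its coverage event is $\bigcup_{i=0}^nS_i$ with $$S_i=\bigcap_{j=0}^{i-1}C_j^{c}\ \cap\ \bigcap_{j=1}^{i}D_j\ \cap\ C_i .$$ Adopt the independence assumption of the model: the pairs (signal power, total interfering power) that enter the decoding attempts $C_0,C_1,\dots,D_1,D_2,\dots$ are replaced by pairs which are mutually independent from one attempt to another, each having the same law as in the network above. Then, for every $n\ge 0$, the probability $\Pi_{SIC}(v,n)$ of the coverage event is $$\Pi_{SIC}(v,n)=\Pi_{NC}(v)+\sum_{i=1}^n\Big[\prod_{j=0}^{i-1}\big(1-\Pi_C(v,j)\big)\Big]\Big[\prod_{j=1}^{i}\Pi_D(v,j)\Big]\Pi_C(v,i).$$ -/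

import Mathlib

open MeasureTheory ProbabilityTheory
open scoped NNReal ENNReal

noncomputable section

/-- The plane in which the nodes live; the typical receiver sits at the origin. -/
abbrev Plane : Type := EuclideanSpace ℝ (Fin 2)

/-- The constants of the system: density `lam` of the interferers, path-loss exponent `alpha`,
distance `d0` between the typical receiver and its transmitter, transmit power `Pt`,
variance `sigma2` of the antenna noise, variance `sigmaC2` of the conversion noise,
SINR threshold `theta`. -/
structure SysParams where
  lam : ℝ
  alpha : ℝ
  d0 : ℝ
  Pt : ℝ
  sigma2 : ℝ
  sigmaC2 : ℝ
  theta : ℝ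

/-- The standing assumptions on the constants. -/
structure SysParams.Valid (p : SysParams) : Prop where
  lam_pos : 0 < p.lam
  two_lt_alpha : 2 < p.alpha
  d0_nonneg : 0 ≤ p.d0
  Pt_pos : 0 < p.Pt
  sigma2_nonneg : 0 ≤ p.sigma2
  sigmaC2_nonneg : 0 ≤ p.sigmaC2
  theta_pos : 0 < p.theta

/-- `τ = 1 + d₀ ^ α`. -/
def SysParams.tau (p : SysParams) : ℝ := 1 + p.d0 ^ p.alpha

section Network

variable {Ω : Type*} [MeasurableSpace Ω]

/-- The number of interferers `x i`, `i ≥ 1`, that lie in `B`. -/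
def pointCount (x : ℕ → Ω → Plane) (B : Set Plane) (ω : Ω) : ℕ∞ :=
  {i : ℕ | 1 ≤ i ∧ x i ω ∈ B}.encard

/-- The points `x 1, x 2, …` form a homogeneous Poisson point process of density `lam` in the
plane: counts of Borel sets of finite area are Poisson with mean `lam * area`, and counts of
pairwise disjoint sets are independent. -/
structure IsPoissonProcess (μ : Measure Ω) (lam : ℝ) (x : ℕ → Ω → Plane) : Prop where
  count_law : ∀ B : Set Plane, MeasurableSet B → volume B ≠ ∞ → ∀ k : ℕ,
    μ {ω | pointCount x B ω = k} =
      poissonMeasure (ENNReal.ofReal lam * volume B).toNNReal {k}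
  count_indep : ∀ (m : ℕ) (B : Fin m → Set Plane),
    (∀ l, MeasurableSet (B l)) → (∀ l, volume (B l) ≠ ∞) →
    Pairwise (fun l l' => Disjoint (B l) (B l')) →
    iIndepFun (fun l => pointCount x (B l)) μ

/-- The bipolar network as seen from the typical receiver at the origin.  `x 0` is the transmitter
associated with it, at distance `d0`; the interferers `x 1, x 2, …` form a homogeneous Poisson
point process and are labelled by increasing distance from the origin; the fading powers `h i` are
independent exponential variables of mean one, independent of all the positions. -/
structure IsBipolarNetwork (μ : Measure Ω) (p : SysParams)
    (x : ℕ → Ω → Plane) (h : ℕ → Ω → ℝ) : Prop where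
  measurable_pos : ∀ i, Measurable (x i)
  measurable_fading : ∀ i, Measurable (h i)
  norm_zero : ∀ᵐ ω ∂μ, ‖x 0 ω‖ = p.d0
  poisson : IsPoissonProcess μ p.lam x
  ordered : ∀ᵐ ω ∂μ, ∀ i, 1 ≤ i → ‖x i ω‖ ≤ ‖x (i + 1) ω‖
  fading_law : ∀ i, μ.map (h i) = expMeasure 1
  fading_indep : iIndepFun h μ
  fading_indep_pos : IndepFun (fun ω i => h i ω) (fun ω i => x i ω) μ

/-- Received power (for unit transmit power) `h_i / (1 + d_i ^ α)` from transmitter `i`,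
where `d_i = ‖x_i‖`. -/
def rxPower (p : SysParams) (x : ℕ → Ω → Plane) (h : ℕ → Ω → ℝ) (i : ℕ) (ω : Ω) : ℝ :=
  h i ω / (1 + ‖x i ω‖ ^ p.alpha)

/-- The interference term `I_j = ∑_{i > j} h_i / (1 + d_i ^ α)`. -/
def interference (p : SysParams) (x : ℕ → Ω → Plane) (h : ℕ → Ω → ℝ) (j : ℕ) (ω : Ω) : ℝ :=
  ∑' i : ℕ, rxPower p x h (j + 1 + i) ω

/-- The decoding attempts that occur in successive interference cancellation:
`useful j` decodes the useful signal when `j` interferers have been cancelled,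
`interferer j` decodes the `j`-th interferer (`j ≥ 1`). -/
inductive Attempt : Type
  | useful (j : ℕ) : Attempt
  | interferer (j : ℕ+) : Attempt

/-- The pair (power of the signal to be decoded, total interfering power) of a decoding attempt.
When an interferer is decoded, the useful signal counts as interference. -/
def attemptTerms (p : SysParams) (x : ℕ → Ω → Plane) (h : ℕ → Ω → ℝ) :
    Attempt → Ω → ℝ × ℝ
  | .useful j, ω => (rxPower p x h 0 ω, interference p x h j ω)
  | .interferer j, ω => (rxPower p x h j ω, interference p x h j ω + rxPower p x h 0 ω)

/-- The SINR with power splitting parameter `v`, for the pair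
`t = (signal power, interfering power)`. -/
def sinr (p : SysParams) (v : ℝ) (t : ℝ × ℝ) : ℝ :=
  v * p.Pt * t.1 / (v * (p.sigma2 + p.Pt * t.2) + p.sigmaC2)

/-- The attempt `a` succeeds: its SINR reaches the threshold. -/
def successEvent (p : SysParams) (v : ℝ) (T : Attempt → Ω → ℝ × ℝ) (a : Attempt) : Set Ω :=
  {ω | p.theta ≤ sinr p v (T a ω)}

/-- The state `S_i`: the useful signal is not decoded after `0, …, i - 1` cancellations, the
interferers `1, …, i` are all decoded, and then the useful signal is decoded. -/
def sicState (p : SysParams) (v : ℝ) (T : Attempt → Ω → ℝ × ℝ) (i : ℕ) : Set Ω :=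
  {ω | (∀ j : ℕ, j < i → ω ∉ successEvent p v T (.useful j)) ∧
    (∀ j : ℕ+, (j : ℕ) ≤ i → ω ∈ successEvent p v T (.interferer j)) ∧
    ω ∈ successEvent p v T (.useful i)}

/-- The receiver that attempts to cancel up to `n` interferers decodes its useful signal. -/
def sicCoverage (p : SysParams) (v : ℝ) (T : Attempt → Ω → ℝ × ℝ) (n : ℕ) : Set Ω :=
  ⋃ i ∈ Finset.range (n + 1), sicState p v T i

end Network

/-- The Gauss hypergeometric function `₂F₁(a, b; c; z)` for real `0 < b < c` and `z < 1`, by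
Euler's integral.  (Mathlib's `ordinaryHypergeometric` is the sum of the power series, hence `0`
for `z < -1`, while here arguments below `-1` are needed.) -/
def gaussHypergeometric (a b c z : ℝ) : ℝ :=
  Real.Gamma c / (Real.Gamma b * Real.Gamma (c - b)) *
    ∫ t in (0 : ℝ)..1, t ^ (b - 1) * (1 - t) ^ (c - b - 1) * (1 - z * t) ^ (-a)

namespace SysParams

/-- Density of the distance from the origin to the `n`-th nearest interferer, `n ≥ 1`. -/
def distDensity (p : SysParams) (r : ℝ) (n : ℕ) : ℝ :=
  2 * (Real.pi * p.lam) ^ n / Real.Gamma n * r ^ (2 * n - 1) * Real.exp (-Real.pi * p.lam * r ^ 2)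

/-- The factor `exp (-(s / Pt) (σ² + σ_C² / v))` due to the noise. -/
def noiseFactor (p : SysParams) (v s : ℝ) : ℝ :=
  Real.exp (-(s / p.Pt) * (p.sigma2 + p.sigmaC2 / v))

/-- The factor `exp (-(2πλ s r^(2-α) / (α-2)) ₂F₁(1, 1 - 2/α; 2 - 2/α; -(1 + s) / r^α))`. -/
def interfFactor (p : SysParams) (s r : ℝ) : ℝ :=
  Real.exp (-(2 * Real.pi * p.lam * s * r ^ (2 - p.alpha) / (p.alpha - 2)) *
    gaussHypergeometric 1 (1 - 2 / p.alpha) (2 - 2 / p.alpha) (-(1 + s) / r ^ p.alpha))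

/-- `Π_NC(v)`: coverage probability without cancellation. -/
def PiNC (p : SysParams) (v : ℝ) : ℝ :=
  p.noiseFactor v (p.theta * p.tau) *
    Real.exp (-(2 * Real.pi ^ 2 * p.lam / p.alpha) * (p.theta * p.tau) *
      (1 + p.theta * p.tau) ^ (2 / p.alpha - 1) * (1 / Real.sin (2 * Real.pi / p.alpha)))

/-- `Π_D(v, n)`, `n ≥ 1`: probability of decoding the `n`-th interferer; here `ξ = 1 + r ^ α`. -/
def PiD (p : SysParams) (v : ℝ) (n : ℕ) : ℝ :=
  ∫ r in Set.Ioi (0 : ℝ),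
    p.distDensity r n / (1 + p.theta * (1 + r ^ p.alpha) * p.tau⁻¹) *
      p.noiseFactor v (p.theta * (1 + r ^ p.alpha)) *
      p.interfFactor (p.theta * (1 + r ^ p.alpha)) r

/-- `Π_C(v, n)`: coverage probability after cancellation of `n` interferers. -/
def PiC (p : SysParams) (v : ℝ) (n : ℕ) : ℝ :=
  if n = 0 then p.PiNC v
  else p.noiseFactor v (p.theta * p.tau) *
    ∫ r in Set.Ioi (0 : ℝ), p.distDensity r n * p.interfFactor (p.theta * p.tau) r

end SysParams

end

/-! Given the positions, success means $h_m\ge b+\sum_i c_i h_i$ with nonnegative constants $b,c_i$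
and $c_m=0$. Since $h_m$ is standard exponential and independent of the other fading powers, this
has conditional probability $e^{-b}\prod_i(1+c_i)^{-1}$ (`measure_add_tsum_le_fading`, then
`measure_add_tsum_le_fading_of_indepFun` for random positions). The $c_i$ of the interferers are
$s\,(1+\|x_i\|^\alpha)^{-1}$, with $s=\theta\tau$ or $s=\theta\xi$; when an interferer is decoded,
the useful signal adds the factor $(1+\theta\xi\tau^{-1})^{-1}$.

The average of the product over the positions is a Laplace functional. Given $\|x_n\|=r$, the
farther points form a Poisson process outside the disc of radius $r$
(`integral_mul_exp_neg_tsum_beyond`), so the average is $\exp(-\lambda\int_{\|y\|\ge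
r}\frac{s}{1+s+\|y\|^\alpha}\,dy)$. Polar coordinates and $t=(r/u)^\alpha$ turn it into $G(s,r)$ by
Euler's integral; for $r=0$ the reflection formula of the Gamma function gives the cosecant. The
radius has density $f(r,n)$ because $\|x_n\|\ge r$ says that the disc holds fewer than $n$ points
(`map_norm_eq_withDensity`).

The conditioning uses no conditional expectation. The event $\|x_n\|\ge c$ depends only on the count
in a disc, hence is independent of sums over points outside it. Differences of such events give
cells $c\le\|x_n\|<d$, and refining the cells gives the limit.

The SIC formula then uses only that the states $S_i$ are disjoint and that each is an intersection
of events of distinct, hence independent, decodings (`measureReal_sicCoverage`). -/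

/-! ### Exponential fading: tails and Laplace transforms. -/

theorem integral_exp_neg_mul_expMeasure {c : ℝ} (hc : -1 < c) :
    ∫ x, Real.exp (-c * x) ∂(expMeasure 1) = (1 + c)⁻¹ := by
  have hpdf : ∀ x : ℝ, (gammaPDF 1 1 x).toReal = (Set.Ici (0 : ℝ)).indicator
      (fun x => Real.exp (-x)) x := by
    intro x
    by_cases hx : 0 ≤ x
    · simp [gammaPDF, gammaPDFReal, hx, Real.exp_nonneg]
    · simp [gammaPDF, gammaPDFReal, hx]
  have hm : Measurable (gammaPDF 1 1) :=
    ENNReal.measurable_ofReal.comp (measurable_gammaPDFReal 1 1)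
  rw [expMeasure, gammaMeasure, integral_withDensity_eq_integral_toReal_smul hm
    (Filter.Eventually.of_forall fun x => by simp [gammaPDF])]
  have h2 : ∀ x : ℝ, (gammaPDF 1 1 x).toReal • Real.exp (-c * x) =
      (Set.Ici (0 : ℝ)).indicator (fun x => Real.exp (-(1 + c) * x)) x := by
    intro x
    rw [hpdf]
    by_cases hx : x ∈ Set.Ici (0 : ℝ)
    · rw [Set.indicator_of_mem hx, Set.indicator_of_mem hx, smul_eq_mul, ← Real.exp_add]
      ring_nf
    · rw [Set.indicator_of_notMem hx, Set.indicator_of_notMem hx, zero_smul]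
  simp_rw [h2]
  rw [integral_indicator measurableSet_Ici, integral_Ici_eq_integral_Ioi,
    integral_exp_mul_Ioi (by linarith)]
  simp [div_eq_mul_inv, neg_inv]

/-- A non-integrable function has integral `0` by convention, whereas the value just computed is
nonzero. -/
theorem integrable_exp_neg_mul_expMeasure {c : ℝ} (hc : -1 < c) :
    Integrable (fun x => Real.exp (-c * x)) (expMeasure 1) := by
  by_contra h
  have := integral_exp_neg_mul_expMeasure hc
  rw [integral_undef h] at this
  have h3 : (1 + c)⁻¹ ≠ 0 := inv_ne_zero (by linarith)
  exact h3 this.symm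

theorem expMeasure_one_Ici {y : ℝ} (hy : 0 ≤ y) :
    expMeasure 1 (Set.Ici y) = ENNReal.ofReal (Real.exp (-y)) := by
  have := isProbabilityMeasure_expMeasure (r := 1) one_pos
  have h0 : expMeasure 1 {y} = 0 :=
    (withDensity_absolutelyContinuous _ _) (by simp)
  have h1 : expMeasure 1 (Set.Ici y) = expMeasure 1 (Set.Ioi y) := by
    rw [← Set.Ioi_union_left]
    refine le_antisymm ((measure_union_le _ _).trans (by rw [h0, add_zero]))
      (measure_mono Set.subset_union_left)
  have h2 := cdf_expMeasure_eq (r := 1) one_pos y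
  rw [cdf_eq_real, if_pos hy, one_mul] at h2
  rw [h1, ← Set.compl_Iic, ← ofReal_measureReal, probReal_compl_eq_one_sub measurableSet_Iic, h2]
  congr 1; ring

theorem expMeasure_one_Iic_zero : expMeasure 1 (Set.Iic 0) = 0 := by
  have := isProbabilityMeasure_expMeasure (r := 1) one_pos
  have h2 := cdf_expMeasure_eq (r := 1) one_pos 0
  rw [cdf_eq_real] at h2
  simpa [measureReal_def, ENNReal.toReal_eq_zero_iff] using h2

section Fading

variable {Ω : Type*} [MeasurableSpace Ω] {μ : Measure Ω} {h : ℕ → Ω → ℝ}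

theorem ae_fading_pos (hm : ∀ i, Measurable (h i)) (hl : ∀ i, μ.map (h i) = expMeasure 1) :
    ∀ᵐ ω ∂μ, ∀ i, 0 < h i ω := by
  rw [ae_all_iff]
  intro i
  have := expMeasure_one_Iic_zero
  rw [← hl i, Measure.map_apply (hm i) measurableSet_Iic] at this
  rw [ae_iff]
  convert this using 2
  ext ω; simp

/-- Any bound uniform in `i` would do. This one comes from $x\le 2e^{x/2}$ and $\mathbb
E\,e^{h/2}=2$, so that the Laplace transform above suffices. -/
theorem lintegral_fading_le (hm : ∀ i, Measurable (h i))
    (hl : ∀ i, μ.map (h i) = expMeasure 1) (i : ℕ) :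
    ∫⁻ ω, ENNReal.ofReal (h i ω) ∂μ ≤ 4 := by
  have h1 : ∫⁻ ω, ENNReal.ofReal (h i ω) ∂μ = ∫⁻ x, ENNReal.ofReal x ∂(expMeasure 1) := by
    rw [← hl i, lintegral_map ENNReal.measurable_ofReal (hm i)]
  rw [h1]
  calc ∫⁻ x, ENNReal.ofReal x ∂(expMeasure 1)
      ≤ ∫⁻ x, ENNReal.ofReal (2 * Real.exp (-(-(1 / 2)) * x)) ∂(expMeasure 1) := by
        refine lintegral_mono fun x => ENNReal.ofReal_le_ofReal ?_
        have := Real.add_one_le_exp (-(-(1 / 2)) * x)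
        linarith
    _ = ENNReal.ofReal (∫ x, 2 * Real.exp (-(-(1 / 2)) * x) ∂(expMeasure 1)) := by
        rw [ofReal_integral_eq_lintegral_ofReal]
        · exact (integrable_exp_neg_mul_expMeasure (by norm_num)).const_mul 2
        · exact Filter.Eventually.of_forall fun x => by positivity
    _ ≤ 4 := by
        rw [integral_const_mul, integral_exp_neg_mul_expMeasure (by norm_num)]
        norm_num

/-- By Tonelli the sum has finite expectation. -/
theorem ae_summable_mul_fading (hm : ∀ i, Measurable (h i))
    (hl : ∀ i, μ.map (h i) = expMeasure 1) {c : ℕ → ℝ} (hc : ∀ i, 0 ≤ c i) (hs : Summable c) :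
    ∀ᵐ ω ∂μ, Summable fun i => c i * h i ω := by
  have hfin : ∫⁻ ω, ∑' i, ENNReal.ofReal (c i) * ENNReal.ofReal (h i ω) ∂μ ≠ ∞ := by
    rw [lintegral_tsum (fun i => ((hm i).ennreal_ofReal.const_mul _).aemeasurable)]
    refine ne_top_of_le_ne_top (b := ∑' i, ENNReal.ofReal (c i) * 4) ?_ ?_
    · rw [ENNReal.tsum_mul_right]
      refine ENNReal.mul_ne_top ?_ (by simp)
      rw [← ENNReal.ofReal_tsum_of_nonneg hc hs]
      simp
    · refine ENNReal.tsum_le_tsum fun i => ?_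
      rw [lintegral_const_mul _ (hm i).ennreal_ofReal]
      gcongr
      exact lintegral_fading_le hm hl i
  have hae := ae_lt_top (Measurable.tsum fun i => ((hm i).ennreal_ofReal.const_mul _)) hfin
  filter_upwards [hae, ae_fading_pos hm hl] with ω h1 h2
  have := ENNReal.summable_toReal h1.ne
  refine this.congr fun i => ?_
  rw [ENNReal.toReal_mul, ENNReal.toReal_ofReal (hc i), ENNReal.toReal_ofReal (h2 i).le]

theorem summable_log_one_add {c : ℕ → ℝ} (hc : ∀ i, 0 ≤ c i) (hs : Summable c) :
    Summable fun i => Real.log (1 + c i) :=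
  hs.of_nonneg_of_le (fun i => Real.log_nonneg (by linarith [hc i])) fun i => by
    have := Real.log_le_sub_one_of_pos (show 0 < 1 + c i by linarith [hc i]); linarith

variable [IsProbabilityMeasure μ]

/-- Laplace transform of a weighted sum of independent standard exponential variables. -/
theorem integral_exp_neg_tsum_fading (hm : ∀ i, Measurable (h i))
    (hl : ∀ i, μ.map (h i) = expMeasure 1) (hi : iIndepFun h μ) {c : ℕ → ℝ}
    (hc : ∀ i, 0 ≤ c i) (hs : Summable c) :
    ∫ ω, Real.exp (-∑' i, c i * h i ω) ∂μ = Real.exp (-∑' i, Real.log (1 + c i)) := by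
  have hfin : ∀ k : ℕ, ∫ ω, Real.exp (-∑ i ∈ Finset.range k, c i * h i ω) ∂μ =
      Real.exp (-∑ i ∈ Finset.range k, Real.log (1 + c i)) := by
    intro k
    have h1 := (hi.comp (fun i (x : ℝ) => c i * x) (fun i => measurable_const_mul _)).mgf_sum
      (fun i => (measurable_const_mul _).comp (hm i)) (Finset.range k) (t := -1)
    simp only [mgf, Finset.sum_apply, Function.comp_apply, neg_one_mul] at h1
    rw [h1, ← Finset.sum_neg_distrib, Real.exp_sum]
    refine Finset.prod_congr rfl fun i _ => ?_
    rw [Real.exp_neg, Real.exp_log (by linarith [hc i]),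
      ← integral_exp_neg_mul_expMeasure (by linarith [hc i]), ← hl i,
      integral_map (hm i).aemeasurable (by fun_prop)]
    simp
  have hlim : Filter.Tendsto (fun k : ℕ => ∫ ω, Real.exp (-∑ i ∈ Finset.range k, c i * h i ω) ∂μ)
      Filter.atTop (nhds (∫ ω, Real.exp (-∑' i, c i * h i ω) ∂μ)) := by
    refine tendsto_integral_of_dominated_convergence (fun _ => 1) (fun k => ?_)
      (integrable_const _) (fun k => ?_) ?_
    · refine Measurable.aestronglyMeasurable ?_
      exact Real.measurable_exp.comp
        (Finset.measurable_sum _ fun i _ => (hm i).const_mul _).neg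
    · filter_upwards [ae_fading_pos hm hl] with ω h2
      rw [Real.norm_eq_abs, abs_of_pos (Real.exp_pos _), Real.exp_le_one_iff, neg_nonpos]
      exact Finset.sum_nonneg fun i _ => mul_nonneg (hc i) (h2 i).le
    · filter_upwards [ae_summable_mul_fading hm hl hc hs] with ω h2
      exact (Real.continuous_exp.tendsto _).comp h2.hasSum.tendsto_sum_nat.neg
  simp_rw [hfin] at hlim
  refine tendsto_nhds_unique hlim ?_
  exact (Real.continuous_exp.tendsto _).comp
    (summable_log_one_add hc hs).hasSum.tendsto_sum_nat.neg

/-- The weight `c m = 0` makes the sum $Z$ independent of `h m`. Integrating the exponential tail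
over the law of $Z$ gives $\mathbb E\,e^{-b-Z}$, a Laplace transform already known. -/
theorem measure_add_tsum_le_fading (hm : ∀ i, Measurable (h i))
    (hl : ∀ i, μ.map (h i) = expMeasure 1) (hi : iIndepFun h μ) {c : ℕ → ℝ}
    (hc : ∀ i, 0 ≤ c i) (hs : Summable c) {m : ℕ} (hcm : c m = 0) {b : ℝ} (hb : 0 ≤ b) :
    μ {ω | b + ∑' i, c i * h i ω ≤ h m ω} =
      ENNReal.ofReal (Real.exp (-b) * Real.exp (-∑' i, Real.log (1 + c i))) := by
  set Z : Ω → ℝ := fun ω => ∑' i, c i * h i ω with hZ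
  have hZm : Measurable Z := Measurable.tsum fun i => (hm i).const_mul _
  have hZ0 : ∀ᵐ ω ∂μ, 0 ≤ Z ω := by
    filter_upwards [ae_fading_pos hm hl] with ω h2
    exact tsum_nonneg fun i => mul_nonneg (hc i) (h2 i).le
  have hind : IndepFun (h m) Z μ := by
    have h1 := indep_iSup_of_disjoint (m := fun i => MeasurableSpace.comap (h i) inferInstance)
      (fun i => (hm i).comap_le) hi.iIndep (S := {m}) (T := {m}ᶜ) disjoint_compl_right
    rw [IndepFun_iff_Indep]
    refine indep_of_indep_of_le_left (indep_of_indep_of_le_right h1 ?_) ?_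
    · rw [← measurable_iff_comap_le]
      -- Measurability is meant for the σ-algebra generated by the `h i` with `i ≠ m`; the term `i =
      -- m` is the constant `0`.
      refine @Measurable.tsum Ω ℝ ℕ (_) _ _ _ _ _ _ _ _ _ _ _ _ fun i => ?_
      by_cases him : i = m
      · subst him; simp only [hcm, zero_mul]; exact measurable_const
      · refine Measurable.const_mul (Measurable.mono (comap_measurable (h i)) ?_ le_rfl) _
        exact le_iSup₂_of_le (f := fun i (_ : i ∈ ({m}ᶜ : Set ℕ)) =>
          MeasurableSpace.comap (h i) inferInstance) i (by simpa using him) le_rfl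
    · simp
  have hmap := (indepFun_iff_map_prod_eq_prod_map_map (hm m).aemeasurable hZm.aemeasurable).1 hind
  have hset : MeasurableSet {q : ℝ × ℝ | b + q.2 ≤ q.1} :=
    measurableSet_le (by fun_prop) (by fun_prop)
  have h1 : μ {ω | b + Z ω ≤ h m ω} =
      μ.map (fun ω => (h m ω, Z ω)) {q : ℝ × ℝ | b + q.2 ≤ q.1} := by
    rw [Measure.map_apply ((hm m).prodMk hZm) hset]; rfl
  have : IsProbabilityMeasure (μ.map (h m)) := Measure.isProbabilityMeasure_map (hm m).aemeasurable
  rw [h1, hmap, Measure.prod_apply_symm hset, hl m, lintegral_map ?_ hZm]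
  · have h2 : ∀ᵐ ω ∂μ, expMeasure 1 ((fun x => (x, Z ω)) ⁻¹' {q : ℝ × ℝ | b + q.2 ≤ q.1}) =
        ENNReal.ofReal (Real.exp (-b) * Real.exp (-Z ω)) := by
      filter_upwards [hZ0] with ω h0
      rw [← Real.exp_add, ← neg_add, ← expMeasure_one_Ici (by positivity)]
      rfl
    rw [lintegral_congr_ae h2, ← integral_exp_neg_tsum_fading hm hl hi hc hs,
      ← integral_const_mul, ofReal_integral_eq_lintegral_ofReal]
    · refine Integrable.of_bound (C := Real.exp (-b)) ?_ ?_
      · exact (by fun_prop : Measurable fun ω => Real.exp (-b) * Real.exp (-Z ω)).aestronglyMeasurable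
      · filter_upwards [hZ0] with ω h0
        rw [Real.norm_eq_abs, abs_of_pos (by positivity)]
        exact mul_le_of_le_one_right (Real.exp_nonneg _) (by simpa using h0)
    · exact Filter.Eventually.of_forall fun _ => by positivity
  · have := isProbabilityMeasure_expMeasure (r := 1) one_pos
    exact measurable_measure_prodMk_right hset

/-- The version of `measure_add_tsum_le_fading` in which the weights depend on a random element
`y` that is independent of the fading. -/
theorem measure_add_tsum_le_fading_of_indepFun {E : Type*} [MeasurableSpace E] {y : Ω → E}
    (hy : Measurable y) (hm : ∀ i, Measurable (h i))
    (hl : ∀ i, μ.map (h i) = expMeasure 1) (hi : iIndepFun h μ)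
    (hiy : IndepFun (fun ω i => h i ω) y μ) {c : ℕ → E → ℝ} {b : E → ℝ}
    (hcmeas : ∀ i, Measurable (c i)) (hbmeas : Measurable b)
    (hc : ∀ i e, 0 ≤ c i e) (hs : ∀ᵐ ω ∂μ, Summable fun i => c i (y ω)) {m : ℕ}
    (hcm : ∀ e, c m e = 0) (hb : ∀ e, 0 ≤ b e) :
    μ {ω | b (y ω) + ∑' i, c i (y ω) * h i ω ≤ h m ω} =
      ENNReal.ofReal (∫ ω, Real.exp (-b (y ω)) *
        Real.exp (-∑' i, Real.log (1 + c i (y ω))) ∂μ) := by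
  have hH : Measurable fun ω i => h i ω := measurable_pi_lambda _ hm
  have hmap := (indepFun_iff_map_prod_eq_prod_map_map hH.aemeasurable hy.aemeasurable).1 hiy
  have hset : MeasurableSet {q : (ℕ → ℝ) × E | b q.2 + ∑' i, c i q.2 * q.1 i ≤ q.1 m} := by
    refine measurableSet_le ?_ (by fun_prop)
    exact (hbmeas.comp measurable_snd).add (Measurable.tsum fun i =>
      ((hcmeas i).comp measurable_snd).mul (by fun_prop))
  have h1 : μ {ω | b (y ω) + ∑' i, c i (y ω) * h i ω ≤ h m ω} =
      μ.map (fun ω => ((fun i => h i ω), y ω))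
        {q : (ℕ → ℝ) × E | b q.2 + ∑' i, c i q.2 * q.1 i ≤ q.1 m} := by
    rw [Measure.map_apply (hH.prodMk hy) hset]; rfl
  have : IsProbabilityMeasure (μ.map fun ω i => h i ω) :=
    Measure.isProbabilityMeasure_map hH.aemeasurable
  rw [h1, hmap, Measure.prod_apply_symm hset,
    lintegral_map (measurable_measure_prodMk_right hset) hy]
  have hmeas : Measurable fun ω => Real.exp (-b (y ω)) *
      Real.exp (-∑' i, Real.log (1 + c i (y ω))) := by
    refine (Real.measurable_exp.comp (hbmeas.comp hy).neg).mul
      (Real.measurable_exp.comp (Measurable.tsum fun i => ?_).neg)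
    exact Real.measurable_log.comp (((hcmeas i).comp hy).const_add 1)
  rw [ofReal_integral_eq_lintegral_ofReal]
  · refine lintegral_congr_ae ?_
    filter_upwards [hs] with ω hω
    rw [← measure_add_tsum_le_fading hm hl hi (fun i => hc i (y ω)) hω (hcm _) (hb _),
      Measure.map_apply hH (measurable_prodMk_right hset)]
    rfl
  · refine Integrable.of_bound (C := 1) hmeas.aestronglyMeasurable ?_
    refine Filter.Eventually.of_forall fun ω => ?_
    rw [Real.norm_eq_abs, abs_of_pos (by positivity), ← Real.exp_add, Real.exp_le_one_iff]
    have : 0 ≤ ∑' i, Real.log (1 + c i (y ω)) :=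
      tsum_nonneg fun i => Real.log_nonneg (by linarith [hc i (y ω)])
    linarith [hb (y ω)]
  · exact Filter.Eventually.of_forall fun _ => by positivity

end Fading

/-! ### Poisson process: law of the counts and Campbell's formula. -/

section Poisson

variable {Ω : Type*} [MeasurableSpace Ω] {μ : Measure Ω} {lam : ℝ} {x : ℕ → Ω → Plane}

/-- As a series of indicators, a count is visibly measurable and its mean can be computed term by
term. The shift `i + 1` skips the transmitter `x 0`. -/
theorem coe_pointCount {Ω : Type*} {x : ℕ → Ω → Plane} (B : Set Plane) (ω : Ω) :
    (pointCount x B ω : ℝ≥0∞) = ∑' i : ℕ, B.indicator 1 (x (i + 1) ω) := by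
  have h1 : pointCount x B ω = {i : ℕ | x (i + 1) ω ∈ B}.encard := by
    have : {i : ℕ | 1 ≤ i ∧ x i ω ∈ B} = Nat.succ '' {i : ℕ | x (i + 1) ω ∈ B} := by
      ext i
      constructor
      · rintro ⟨h1, h2⟩
        exact ⟨i - 1, by simpa [Nat.sub_add_cancel h1] using h2, by simp; omega⟩
      · rintro ⟨j, hj, rfl⟩
        exact ⟨by simp, hj⟩
    rw [pointCount, this, Nat.succ_injective.encard_image]
  rw [h1, ← ENNReal.tsum_set_one, tsum_subtype {i : ℕ | x (i + 1) ω ∈ B} (fun _ => (1 : ℝ≥0∞))]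
  rfl

theorem measurable_pointCount (hx : ∀ i, Measurable (x i)) {B : Set Plane}
    (hB : MeasurableSet B) : Measurable (pointCount x B) := by
  refine measurable_to_countable' fun k => ?_
  have h1 : Measurable fun ω => (pointCount x B ω : ℝ≥0∞) := by
    simp_rw [coe_pointCount]
    exact Measurable.tsum fun i => (measurable_one.indicator hB).comp (hx (i + 1))
  convert h1 (measurableSet_singleton (k : ℝ≥0∞)) using 1
  ext ω; simp

variable [IsProbabilityMeasure μ]

namespace IsPoissonProcess

theorem map_pointCount (hP : IsPoissonProcess μ lam x) (hx : ∀ i, Measurable (x i))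
    {B : Set Plane} (hB : MeasurableSet B) (hv : volume B ≠ ∞) :
    μ.map (pointCount x B) =
      (poissonMeasure (ENNReal.ofReal lam * volume B).toNNReal).map (Nat.cast : ℕ → ℕ∞) := by
  have hm := measurable_pointCount hx hB
  have hcast : Measurable (Nat.cast : ℕ → ℕ∞) := measurable_from_top
  have : IsProbabilityMeasure (μ.map (pointCount x B)) :=
    Measure.isProbabilityMeasure_map hm.aemeasurable
  set ρ := (ENNReal.ofReal lam * volume B).toNNReal
  have key : ∀ k : ℕ, μ.map (pointCount x B) {(k : ℕ∞)} =
      (poissonMeasure ρ).map (Nat.cast : ℕ → ℕ∞) {(k : ℕ∞)} := by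
    intro k
    rw [Measure.map_apply hm (measurableSet_singleton _),
      Measure.map_apply hcast (measurableSet_singleton _)]
    have h1 : (Nat.cast : ℕ → ℕ∞) ⁻¹' {(k : ℕ∞)} = {k} := by ext; simp
    rw [h1, ← hP.count_law B hB hv k]
    rfl
  have hfin : ∀ s : Set ℕ, μ.map (pointCount x B) (Nat.cast '' s) =
      (poissonMeasure ρ).map (Nat.cast : ℕ → ℕ∞) (Nat.cast '' s) := by
    intro s
    have h2 : (Nat.cast '' s : Set ℕ∞) = ⋃ k ∈ s, {(k : ℕ∞)} := by ext; simp [eq_comm]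
    have hd : s.PairwiseDisjoint fun k => ({(k : ℕ∞)} : Set ℕ∞) := by
      intro a _ b _ hab
      simpa using hab
    rw [h2, measure_biUnion s.to_countable hd (fun _ _ => measurableSet_singleton _),
      measure_biUnion s.to_countable hd (fun _ _ => measurableSet_singleton _)]
    simp_rw [key]
  -- The finite values already carry total mass one, so the mass at `⊤` is determined by
  -- complementation.
  have htop : ({⊤} : Set ℕ∞) = (Nat.cast '' (Set.univ : Set ℕ))ᶜ := by
    ext a; induction a using ENat.recTopCoe <;> simp
  have key' : ∀ k : ℕ∞, μ.map (pointCount x B) {k} =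
      (poissonMeasure ρ).map (Nat.cast : ℕ → ℕ∞) {k} := by
    intro k
    induction k using ENat.recTopCoe with
    | top =>
      rw [htop, prob_compl_eq_one_sub (Set.to_countable _).measurableSet,
        prob_compl_eq_one_sub (Set.to_countable _).measurableSet, hfin]
    | coe k => exact key k
  exact Measure.ext_of_singleton key'

theorem ae_pointCount_ne_top (hP : IsPoissonProcess μ lam x) (hx : ∀ i, Measurable (x i))
    {B : Set Plane} (hB : MeasurableSet B) (hv : volume B ≠ ∞) :
    ∀ᵐ ω ∂μ, pointCount x B ω ≠ ⊤ := by
  have hm := measurable_pointCount hx hB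
  have hcast : Measurable (Nat.cast : ℕ → ℕ∞) := measurable_from_top
  have h1 : μ.map (pointCount x B) {⊤} = 0 := by
    rw [hP.map_pointCount hx hB hv, Measure.map_apply hcast (measurableSet_singleton _)]
    have : (Nat.cast : ℕ → ℕ∞) ⁻¹' {⊤} = ∅ := by ext; simp
    rw [this, measure_empty]
  rw [Measure.map_apply hm (measurableSet_singleton _)] at h1
  rw [ae_iff]
  simpa [Set.preimage] using h1

theorem integral_comp_pointCount (hP : IsPoissonProcess μ lam x) (hx : ∀ i, Measurable (x i))
    {B : Set Plane} (hB : MeasurableSet B) (hv : volume B ≠ ∞) (φ : ℕ∞ → ℝ) :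
    ∫ ω, φ (pointCount x B ω) ∂μ =
      ∑' k : ℕ, (Real.exp (-(lam.toNNReal * (volume B).toNNReal : ℝ≥0)) *
        (lam.toNNReal * (volume B).toNNReal : ℝ≥0) ^ k / k.factorial) * φ k := by
  have hm := measurable_pointCount hx hB
  rw [← integral_map (f := φ) hm.aemeasurable (by fun_prop), hP.map_pointCount hx hB hv,
    integral_map_cast_poissonMeasure, ENNReal.toNNReal_mul]
  rfl

theorem integral_exp_neg_mul_pointCount (hP : IsPoissonProcess μ lam x) (hlam : 0 ≤ lam)
    (hx : ∀ i, Measurable (x i))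
    {B : Set Plane} (hB : MeasurableSet B) (hv : volume B ≠ ∞) (c : ℝ) :
    ∫ ω, Real.exp (-c * (pointCount x B ω).toNat) ∂μ =
      Real.exp (-(lam * volume.real B * (1 - Real.exp (-c)))) := by
  rw [hP.integral_comp_pointCount hx hB hv fun k => Real.exp (-c * k.toNat)]
  simp only [ENat.toNat_natCast, NNReal.coe_mul, Real.coe_toNNReal _ hlam, ENNReal.coe_toNNReal_eq_toReal,
    ← measureReal_def]
  generalize lam * volume.real B = ρ
  have h1 : ∀ k : ℕ, Real.exp (-ρ) * ρ ^ k / k.factorial * Real.exp (-c * k) =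
      Real.exp (-ρ) * ((ρ * Real.exp (-c)) ^ k / k.factorial) := by
    intro k
    rw [mul_pow ρ, ← Real.exp_nat_mul, mul_comm (k : ℝ)]
    ring
  simp_rw [h1]
  rw [tsum_mul_left, (NormedSpace.expSeries_div_hasSum_exp (ρ * Real.exp (-c))).tsum_eq,
    ← Real.exp_eq_exp_ℝ, ← Real.exp_add]
  ring_nf

theorem lintegral_pointCount (hP : IsPoissonProcess μ lam x) (hx : ∀ i, Measurable (x i))
    {B : Set Plane} (hB : MeasurableSet B) (hv : volume B ≠ ∞) :
    ∫⁻ ω, (pointCount x B ω : ℝ≥0∞) ∂μ = ENNReal.ofReal lam * volume B := by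
  have hm := measurable_pointCount hx hB
  have hcast : Measurable (Nat.cast : ℕ → ℕ∞) := measurable_from_top
  have h0 : Measurable fun k : ℕ∞ => (k : ℝ≥0∞) := measurable_from_top
  rw [← lintegral_map h0 hm, hP.map_pointCount hx hB hv, lintegral_map h0 hcast]
  have hne : ENNReal.ofReal lam * volume B ≠ ∞ := ENNReal.mul_ne_top (by simp) hv
  conv_rhs => rw [← ENNReal.coe_toNNReal hne]
  set ρ := (ENNReal.ofReal lam * volume B).toNNReal
  rw [poissonMeasure, lintegral_sum_measure]
  simp only [lintegral_smul_measure, lintegral_dirac, smul_eq_mul]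
  rw [tsum_eq_zero_add' ENNReal.summable]
  have h2 : ∀ n : ℕ, ENNReal.ofReal (Real.exp (-ρ) * ρ ^ (n + 1) / (n + 1).factorial) *
      (((n + 1 : ℕ) : ℕ∞) : ℝ≥0∞) =
      ENNReal.ofReal (Real.exp (-ρ) * ρ ^ n / n.factorial) * ρ := by
    intro n
    have : (((n + 1 : ℕ) : ℕ∞) : ℝ≥0∞) = ENNReal.ofReal (n + 1 : ℕ) := by
      rw [ENNReal.ofReal_natCast]; rfl
    rw [this, ← ENNReal.ofReal_mul (by positivity), ← ENNReal.ofReal_coe_nnreal,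
      ← ENNReal.ofReal_mul (by positivity)]
    congr 1
    rw [Nat.factorial_succ]
    push_cast
    field_simp
    ring
  simp_rw [h2, ENNReal.tsum_mul_right]
  rw [← ENNReal.ofReal_tsum_of_nonneg (fun n => by positivity) (hasSum_one_poissonMeasure ρ).summable,
    (hasSum_one_poissonMeasure ρ).tsum_eq]
  simp

/-- The intensity measure of the process is `lam` times the area. -/
theorem sum_map_eq (hP : IsPoissonProcess μ lam x) (hx : ∀ i, Measurable (x i)) :
    Measure.sum (fun i : ℕ => μ.map (x (i + 1))) = ENNReal.ofReal lam • volume := by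
  have hfin : ∀ B : Set Plane, MeasurableSet B → volume B ≠ ∞ →
      Measure.sum (fun i : ℕ => μ.map (x (i + 1))) B = (ENNReal.ofReal lam • volume) B := by
    intro B hB hv
    rw [Measure.smul_apply, smul_eq_mul, ← hP.lintegral_pointCount hx hB hv,
      Measure.sum_apply _ hB]
    simp_rw [coe_pointCount]
    rw [lintegral_tsum (f := fun i ω => B.indicator 1 (x (i + 1) ω))
      fun i => ((measurable_one.indicator hB).comp (hx (i + 1))).aemeasurable]
    refine tsum_congr fun i => ?_
    rw [Measure.map_apply (hx _) hB, ← lintegral_indicator_one (hx (i + 1) hB)]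
    rfl
  refine Measure.ext fun B hB => ?_
  -- The count law covers only sets of finite area, so a general set is exhausted by its traces on
  -- balls.
  have hU : B = ⋃ k : ℕ, B ∩ Metric.ball 0 k := by
    rw [← Set.inter_iUnion, Metric.iUnion_ball_nat, Set.inter_univ]
  have hmono : Monotone fun k : ℕ => B ∩ Metric.ball (0 : Plane) k := fun a b hab =>
    Set.inter_subset_inter_right _ (Metric.ball_subset_ball (by exact_mod_cast hab))
  rw [hU, hmono.measure_iUnion, hmono.measure_iUnion]
  refine iSup_congr fun k => hfin _ (hB.inter measurableSet_ball) ?_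
  exact ((measure_mono Set.inter_subset_right).trans_lt measure_ball_lt_top).ne

/-- Campbell's formula: the expected sum over the points is an integral against the intensity
measure. -/
theorem lintegral_tsum_eq (hP : IsPoissonProcess μ lam x) (hx : ∀ i, Measurable (x i))
    {f : Plane → ℝ≥0∞} (hf : Measurable f) :
    ∫⁻ ω, ∑' i : ℕ, f (x (i + 1) ω) ∂μ = ENNReal.ofReal lam * ∫⁻ y, f y := by
  rw [← smul_eq_mul, ← lintegral_smul_measure, ← hP.sum_map_eq hx, lintegral_sum_measure,
    lintegral_tsum (f := fun i ω => f (x (i + 1) ω)) fun i => (hf.comp (hx _)).aemeasurable]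
  exact tsum_congr fun i => (lintegral_map hf (hx _)).symm

theorem ae_summable (hP : IsPoissonProcess μ lam x) (hx : ∀ i, Measurable (x i))
    {f : Plane → ℝ} (hf : Measurable f) (hf0 : ∀ y, 0 ≤ f y) (hfi : Integrable f) :
    ∀ᵐ ω ∂μ, Summable fun i : ℕ => f (x (i + 1) ω) := by
  have h1 := hP.lintegral_tsum_eq hx hf.ennreal_ofReal
  have h2 : ∫⁻ ω, ∑' i : ℕ, ENNReal.ofReal (f (x (i + 1) ω)) ∂μ ≠ ∞ := by
    rw [h1, ← ofReal_integral_eq_lintegral_ofReal hfi (Filter.Eventually.of_forall hf0)]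
    exact ENNReal.mul_ne_top (by simp) (by simp)
  filter_upwards [ae_lt_top (Measurable.tsum fun i => (hf.comp (hx _)).ennreal_ofReal) h2] with ω hω
  refine (ENNReal.summable_toReal hω.ne).congr fun i => ?_
  simp [hf0]

end IsPoissonProcess

end Poisson

/-! ### Laplace functional of the Poisson process. -/

section Poisson

variable {Ω : Type*} [MeasurableSpace Ω] {μ : Measure Ω} {lam : ℝ} {x : ℕ → Ω → Plane}

namespace IsPoissonProcess

theorem iIndepFun_pointCount (hP : IsPoissonProcess μ lam x) {ι : Type*} [Fintype ι]
    {B : ι → Set Plane} (hB : ∀ l, MeasurableSet (B l)) (hv : ∀ l, volume (B l) ≠ ∞)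
    (hd : Pairwise fun l l' => Disjoint (B l) (B l')) :
    iIndepFun (fun l => pointCount x (B l)) μ := by
  let e := Fintype.equivFin ι
  have h1 := (hP.count_indep (Fintype.card ι) (fun l => B (e.symm l)) (fun l => hB _)
    (fun l => hv _) (fun l l' hll => hd (e.symm.injective.ne hll))).precomp (g := e) e.injective
  simpa using h1

theorem integral_mul_prod_exp [IsProbabilityMeasure μ] (hP : IsPoissonProcess μ lam x) (hlam : 0 ≤ lam)
    (hx : ∀ i, Measurable (x i)) {ι : Type*} [Fintype ι]
    {B : ι → Set Plane} (hB : ∀ l, MeasurableSet (B l)) (hv : ∀ l, volume (B l) ≠ ∞)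
    (hd : Pairwise fun l l' => Disjoint (B l) (B l')) {B₀ : Set Plane} (hB₀ : MeasurableSet B₀)
    (hv₀ : volume B₀ ≠ ∞) (hd₀ : ∀ l, Disjoint B₀ (B l)) (c : ι → ℝ) (ψ : ℕ∞ → ℝ) :
    ∫ ω, ψ (pointCount x B₀ ω) * ∏ l, Real.exp (-c l * (pointCount x (B l) ω).toNat) ∂μ =
      (∫ ω, ψ (pointCount x B₀ ω) ∂μ) *
        ∏ l, Real.exp (-(lam * volume.real (B l) * (1 - Real.exp (-c l)))) := by
  -- Adjoining `B₀` as the index `none` turns the statement into one product formula for an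
  -- independent family.
  let B' : Option ι → Set Plane := fun o => o.elim B₀ B
  have hB' : ∀ o, MeasurableSet (B' o) := fun o => by cases o; exacts [hB₀, hB _]
  have hv' : ∀ o, volume (B' o) ≠ ∞ := fun o => by cases o; exacts [hv₀, hv _]
  have hd' : Pairwise fun l l' => Disjoint (B' l) (B' l') := by
    intro o o' hne
    rcases o with _ | l <;> rcases o' with _ | l'
    · exact absurd rfl hne
    · exact hd₀ l'
    · exact (hd₀ l).symm
    · exact hd fun h => hne (by rw [h])
  let f : Option ι → ℕ∞ → ℝ := fun o => o.elim ψ fun l k => Real.exp (-c l * k.toNat)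
  have h1 := (hP.iIndepFun_pointCount hB' hv' hd').integral_fun_prod_comp (f := f)
    (fun o => (measurable_pointCount hx (hB' o)).aemeasurable)
    (fun o => (measurable_from_top : Measurable (f o)).aestronglyMeasurable)
  simp only [Fintype.prod_option] at h1
  refine h1.trans ?_
  congr 1
  exact Finset.prod_congr rfl fun l _ => hP.integral_exp_neg_mul_pointCount hlam hx (hB l) (hv l) _

end IsPoissonProcess

theorem ENat_toNat_eq_toReal (k : ℕ∞) : (k.toNat : ℝ) = (k : ℝ≥0∞).toReal := by
  induction k using ENat.recTopCoe <;> simp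

/-- The points are grouped by the value of `f`. The value `0` is left out: it contributes nothing,
and its fibre may contain infinitely many points. -/
theorem hasSum_simpleFunc {Ω : Type*} {x : ℕ → Ω → Plane} (f : SimpleFunc Plane ℝ) {ω : Ω}
    (hω : ∀ c ≠ 0, pointCount x (f ⁻¹' {c}) ω ≠ ⊤) :
    HasSum (fun i : ℕ => f (x (i + 1) ω))
      (∑ c ∈ f.range.filter (· ≠ 0), c * (pointCount x (f ⁻¹' {c}) ω).toNat) := by
  have h1 : ∀ i : ℕ, f (x (i + 1) ω) =
      ∑ c ∈ f.range.filter (· ≠ 0), c * (f ⁻¹' {c}).indicator 1 (x (i + 1) ω) := by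
    intro i
    by_cases h0 : f (x (i + 1) ω) = 0
    · rw [h0, Finset.sum_eq_zero]
      intro c hc
      rw [Set.indicator_of_notMem, mul_zero]
      simpa [h0] using (Finset.mem_filter.1 hc).2.symm
    · rw [Finset.sum_eq_single_of_mem (f (x (i + 1) ω)) (by simp [h0])]
      · simp
      · intro c _ hc
        rw [Set.indicator_of_notMem (by simpa using hc.symm), mul_zero]
  simp_rw [h1]
  refine hasSum_sum fun c hc => HasSum.mul_left _ ?_
  have hne := hω c (Finset.mem_filter.1 hc).2
  have hne' : (pointCount x (f ⁻¹' {c}) ω : ℝ≥0∞) ≠ ∞ := by simpa using hne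
  rw [ENat_toNat_eq_toReal, coe_pointCount]
  rw [coe_pointCount] at hne'
  have h2 := (ENNReal.summable_toReal hne').hasSum
  rw [← ENNReal.tsum_toReal_eq (fun i => ENNReal.ne_top_of_tsum_ne_top hne' i)] at h2
  suffices h3 : ∀ i : ℕ, ((f ⁻¹' {c}).indicator (1 : Plane → ℝ) (x (i + 1) ω)) =
      ((f ⁻¹' {c}).indicator (1 : Plane → ℝ≥0∞) (x (i + 1) ω)).toReal by
    simp_rw [h3]
    exact h2
  intro i
  by_cases h : x (i + 1) ω ∈ f ⁻¹' {c}
  · rw [Set.indicator_of_mem h, Set.indicator_of_mem h]; simp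
  · rw [Set.indicator_of_notMem h, Set.indicator_of_notMem h]; simp

namespace IsPoissonProcess

variable [IsProbabilityMeasure μ]

/-- The fibres of the nonzero values are finitely many disjoint sets of finite area, disjoint also
from `B` where `f` vanishes. The counts are therefore independent and the expectation factorises. -/
theorem integral_mul_exp_neg_tsum_simpleFunc (hP : IsPoissonProcess μ lam x) (hlam : 0 ≤ lam)
    (hx : ∀ i, Measurable (x i)) (f : SimpleFunc Plane ℝ) (hf : Integrable f)
    {B : Set Plane} (hB : MeasurableSet B) (hv : volume B ≠ ∞) (hfB : ∀ y ∈ B, f y = 0)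
    (ψ : ℕ∞ → ℝ) :
    ∫ ω, ψ (pointCount x B ω) * Real.exp (-∑' i : ℕ, f (x (i + 1) ω)) ∂μ =
      (∫ ω, ψ (pointCount x B ω) ∂μ) *
        Real.exp (-(lam * ∫ y, (1 - Real.exp (-f y)))) := by
  have hfin : ∀ c ≠ 0, volume (f ⁻¹' {c}) ≠ ∞ := fun c hc =>
    (SimpleFunc.integrable_iff.1 hf c hc).ne
  set s := f.range.filter (· ≠ 0) with hs
  have hae : ∀ᵐ ω ∂μ, ∀ c : s, pointCount x (f ⁻¹' {(c : ℝ)}) ω ≠ ⊤ := by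
    rw [ae_all_iff]
    exact fun c => hP.ae_pointCount_ne_top hx (f.measurableSet_fiber _)
      (hfin _ (Finset.mem_filter.1 c.2).2)
  have h1 := hP.integral_mul_prod_exp hlam hx (ι := s) (B := fun c => f ⁻¹' {(c : ℝ)})
    (fun c => f.measurableSet_fiber _) (fun c => hfin _ (Finset.mem_filter.1 c.2).2)
    (fun c c' hc => Disjoint.preimage _
      (Set.disjoint_singleton.2 fun h => hc (Subtype.ext h))) hB hv
    (fun c => Set.disjoint_left.2 fun y hy hy' => (Finset.mem_filter.1 c.2).2
      (by rw [← hfB y hy]; exact hy'.symm)) (fun c => c) ψ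
  refine (integral_congr_ae ?_).trans (h1.trans ?_)
  · filter_upwards [hae] with ω hω
    have h2 : ∀ c ≠ 0, pointCount x (f ⁻¹' {c}) ω ≠ ⊤ := by
      intro c hc
      by_cases hr : c ∈ f.range
      · exact hω ⟨c, Finset.mem_filter.2 ⟨hr, hc⟩⟩
      · have : f ⁻¹' {c} = ∅ := by
          ext y
          simp only [Set.mem_preimage, Set.mem_singleton_iff, Set.mem_empty_iff_false, iff_false]
          rintro rfl
          exact hr (f.mem_range_self y)
        simp [this, pointCount]
    rw [(hasSum_simpleFunc f h2).tsum_eq, ← Real.exp_sum, ← hs, ← Finset.sum_neg_distrib,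
      ← Finset.sum_coe_sort s]
    simp
  · rw [← Real.exp_sum]
    congr 2
    have h3 : ∀ y, 1 - Real.exp (-f y) = ∑ c : s, (f ⁻¹' {(c : ℝ)}).indicator
        (fun _ => 1 - Real.exp (-(c : ℝ))) y := by
      intro y
      rw [Finset.sum_coe_sort s (fun c => (f ⁻¹' {c}).indicator (fun _ => 1 - Real.exp (-c)) y)]
      by_cases h0 : f y = 0
      · rw [h0, Finset.sum_eq_zero]
        · simp
        intro c hc
        rw [Set.indicator_of_notMem]
        simpa [h0] using (Finset.mem_filter.1 hc).2.symm
      · rw [Finset.sum_eq_single_of_mem (f y) (by simp [hs, h0])]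
        · simp
        · intro c _ hc
          rw [Set.indicator_of_notMem (by simpa using hc.symm)]
    simp_rw [h3]
    rw [integral_finsetSum]
    · rw [Finset.mul_sum, ← Finset.sum_neg_distrib]
      refine Finset.sum_congr rfl fun c _ => ?_
      rw [integral_indicator_const _ (f.measurableSet_fiber _), smul_eq_mul, mul_assoc]
    · intro c _
      exact (integrable_indicator_iff (f.measurableSet_fiber _)).2
        (integrableOn_const (hfin _ (Finset.mem_filter.1 c.2).2))

/-- The Laplace functional of the process outside of `B`, jointly with the number of points
in `B`. -/
theorem integral_mul_exp_neg_tsum (hP : IsPoissonProcess μ lam x) (hlam : 0 ≤ lam)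
    (hx : ∀ i, Measurable (x i)) {f : Plane → ℝ} (hfm : Measurable f) (hf0 : ∀ y, 0 ≤ f y)
    (hf : Integrable f) {B : Set Plane} (hB : MeasurableSet B) (hv : volume B ≠ ∞)
    (hfB : ∀ y ∈ B, f y = 0) {ψ : ℕ∞ → ℝ} (hψ : ∀ k, |ψ k| ≤ 1) :
    ∫ ω, ψ (pointCount x B ω) * Real.exp (-∑' i : ℕ, f (x (i + 1) ω)) ∂μ =
      (∫ ω, ψ (pointCount x B ω) ∂μ) *
        Real.exp (-(lam * ∫ y, (1 - Real.exp (-f y)))) := by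
  -- Approximation within $[0,\infty)$ from the base value `0` gives $0\le g_k\le 2f$. This bound
  -- dominates the sums over the points and the integral in the exponent, and it keeps `g k` zero on
  -- `B`.
  let g : ℕ → SimpleFunc Plane ℝ := fun k =>
    SimpleFunc.approxOn f hfm (Set.Ici 0) 0 (by simp) k
  have hg0 : ∀ k y, 0 ≤ g k y := fun k y => SimpleFunc.approxOn_mem hfm (by simp) k y
  have hg2 : ∀ k y, g k y ≤ f y + f y := fun k y => by
    have := SimpleFunc.norm_approxOn_zero_le hfm (s := Set.Ici (0 : ℝ)) (by simp) y k
    rw [Real.norm_of_nonneg (hg0 k y), Real.norm_of_nonneg (hf0 y)] at this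
    exact this
  have hglim : ∀ y, Filter.Tendsto (fun k => g k y) Filter.atTop (nhds (f y)) := fun y =>
    SimpleFunc.tendsto_approxOn hfm (by simp) (subset_closure (hf0 y))
  have hgi : ∀ k, Integrable (g k) := fun k =>
    (hf.add hf).mono' (g k).aestronglyMeasurable (Filter.Eventually.of_forall fun y => by
      rw [Real.norm_of_nonneg (hg0 k y)]; exact hg2 k y)
  have hgB : ∀ k, ∀ y ∈ B, g k y = 0 := fun k y hy =>
    le_antisymm (by simpa [hfB y hy] using hg2 k y) (hg0 k y)
  have hsimple := fun k => hP.integral_mul_exp_neg_tsum_simpleFunc hlam hx (g k) (hgi k) hB hv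
    (hgB k) ψ
  have hlim1 : Filter.Tendsto
      (fun k => ∫ ω, ψ (pointCount x B ω) * Real.exp (-∑' i : ℕ, g k (x (i + 1) ω)) ∂μ)
      Filter.atTop
      (nhds (∫ ω, ψ (pointCount x B ω) * Real.exp (-∑' i : ℕ, f (x (i + 1) ω)) ∂μ)) := by
    refine tendsto_integral_of_dominated_convergence (fun _ => 1) (fun k => ?_)
      (integrable_const _) (fun k => ?_) ?_
    · refine Measurable.aestronglyMeasurable ?_
      exact ((measurable_from_top : Measurable ψ).comp (measurable_pointCount hx hB)).mul
        (Real.measurable_exp.comp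
          (Measurable.tsum fun i => (g k).measurable.comp (hx _)).neg)
    · refine Filter.Eventually.of_forall fun ω => ?_
      rw [Real.norm_eq_abs, abs_mul, abs_of_pos (Real.exp_pos _)]
      refine mul_le_one₀ (hψ _) (Real.exp_nonneg _) ?_
      rw [Real.exp_le_one_iff, neg_nonpos]
      exact tsum_nonneg fun i => hg0 k _
    · filter_upwards [hP.ae_summable hx hfm hf0 hf] with ω hω
      refine Filter.Tendsto.const_mul _ ((Real.continuous_exp.tendsto _).comp
        (Filter.Tendsto.neg ?_))
      exact tendsto_tsum_of_dominated_convergence (hω.add hω) (fun i => hglim _)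
        (Filter.Eventually.of_forall fun k i => by
          rw [Real.norm_of_nonneg (hg0 k _)]; exact hg2 k _)
  have hlim2 : Filter.Tendsto (fun k => ∫ y, (1 - Real.exp (-g k y)))
      Filter.atTop (nhds (∫ y, (1 - Real.exp (-f y)))) := by
    refine tendsto_integral_of_dominated_convergence (fun y => f y + f y) (fun k => ?_)
      (hf.add hf) (fun k => ?_) ?_
    · exact (measurable_const.sub
        (Real.measurable_exp.comp (g k).measurable.neg)).aestronglyMeasurable
    · refine Filter.Eventually.of_forall fun y => ?_
      have h1 := Real.add_one_le_exp (-g k y)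
      have h2 : Real.exp (-g k y) ≤ 1 := by simpa using hg0 k y
      rw [Real.norm_of_nonneg (by linarith)]
      linarith [hg2 k y]
    · exact Filter.Eventually.of_forall fun y =>
        ((Real.continuous_exp.tendsto _).comp (hglim y).neg).const_sub 1
  simp_rw [hsimple] at hlim1
  refine tendsto_nhds_unique hlim1 ?_
  exact Filter.Tendsto.const_mul _ ((Real.continuous_exp.tendsto _).comp
    (hlim2.const_mul lam).neg)

end IsPoissonProcess

end Poisson

/-! ### Ordered distances: counts in discs and absence of ties. -/

theorem volume_real_ball_plane {r : ℝ} (hr : 0 ≤ r) :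
    volume.real (Metric.ball (0 : Plane) r) = Real.pi * r ^ 2 := by
  rw [measureReal_def, EuclideanSpace.volume_ball_fin_two, ENNReal.toReal_mul, ENNReal.toReal_pow,
    ENNReal.toReal_ofReal hr, ENNReal.toReal_ofReal Real.pi_pos.le, mul_comm]

/-- This is where the labelling by increasing distance enters: it converts events about the `n`-th
distance into events about counts, to which the Poisson property applies. -/
theorem pointCount_ball_lt_iff {Ω : Type*} {x : ℕ → Ω → Plane} {ω : Ω}
    (hω : ∀ i, 1 ≤ i → ‖x i ω‖ ≤ ‖x (i + 1) ω‖) {n : ℕ} (hn : 1 ≤ n) (c : ℝ) :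
    pointCount x (Metric.ball 0 c) ω < n ↔ c ≤ ‖x n ω‖ := by
  have hmono : ∀ i j, 1 ≤ i → i ≤ j → ‖x i ω‖ ≤ ‖x j ω‖ := by
    intro i j hi hij
    induction j, hij using Nat.le_induction with
    | base => exact le_rfl
    | succ j hj ih => exact ih.trans (hω j (hi.trans hj))
  constructor
  · intro h
    by_contra! hlt
    have hsub : (Finset.Icc 1 n : Set ℕ) ⊆ {i : ℕ | 1 ≤ i ∧ x i ω ∈ Metric.ball 0 c} := by
      intro i hi
      simp only [Finset.coe_Icc, Set.mem_Icc] at hi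
      exact ⟨hi.1, by simpa using (hmono i n hi.1 hi.2).trans_lt hlt⟩
    have := Set.encard_le_encard hsub
    rw [Set.encard_coe_eq_coe_finsetCard, Nat.card_Icc, Nat.add_sub_cancel] at this
    exact absurd h (not_lt.2 this)
  · intro h
    have hsub : {i : ℕ | 1 ≤ i ∧ x i ω ∈ Metric.ball 0 c} ⊆ (Finset.Icc 1 (n - 1) : Set ℕ) := by
      intro i hi
      simp only [Finset.coe_Icc, Set.mem_Icc]
      refine ⟨hi.1, ?_⟩
      by_contra! hlt
      have h1 := hmono n i hn (by omega)
      have h2 : ‖x i ω‖ < c := by simpa using hi.2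
      linarith
    have := Set.encard_le_encard hsub
    rw [Set.encard_coe_eq_coe_finsetCard, Nat.card_Icc, Nat.add_sub_cancel] at this
    refine lt_of_le_of_lt this ?_
    exact_mod_cast Nat.sub_lt hn one_pos

section Poisson

variable {Ω : Type*} [MeasurableSpace Ω] {μ : Measure Ω} [IsProbabilityMeasure μ]
  {lam : ℝ} {x : ℕ → Ω → Plane}

/-- The probability that a Poisson variable of mean `ρ` is less than `n`. -/
noncomputable def poissonLT (n : ℕ) (ρ : ℝ) : ℝ :=
  ∑ k ∈ Finset.range n, Real.exp (-ρ) * ρ ^ k / k.factorial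

namespace IsPoissonProcess

theorem integral_pointCount_lt (hP : IsPoissonProcess μ lam x) (hlam : 0 ≤ lam)
    (hx : ∀ i, Measurable (x i))
    {B : Set Plane} (hB : MeasurableSet B) (hv : volume B ≠ ∞) (n : ℕ) :
    ∫ ω, (if pointCount x B ω < n then 1 else 0 : ℝ) ∂μ = poissonLT n (lam * volume.real B) := by
  rw [hP.integral_comp_pointCount hx hB hv fun k => if k < n then 1 else 0]
  simp only [NNReal.coe_mul, Real.coe_toNNReal _ hlam, ENNReal.coe_toNNReal_eq_toReal,
    ← measureReal_def, Nat.cast_lt]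
  rw [tsum_eq_sum (s := Finset.range n), poissonLT]
  · exact Finset.sum_congr rfl fun k hk => by rw [if_pos (Finset.mem_range.1 hk), mul_one]
  · intro k hk
    rw [if_neg (by simpa using hk), mul_zero]

theorem measureReal_pointCount_lt (hP : IsPoissonProcess μ lam x) (hlam : 0 ≤ lam)
    (hx : ∀ i, Measurable (x i))
    {B : Set Plane} (hB : MeasurableSet B) (hv : volume B ≠ ∞) (n : ℕ) :
    μ.real {ω | pointCount x B ω < n} = poissonLT n (lam * volume.real B) := by
  rw [← hP.integral_pointCount_lt hlam hx hB hv n]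
  have hm : MeasurableSet {ω | pointCount x B ω < n} :=
    measurable_pointCount hx hB (Set.to_countable (Set.Iio (n : ℕ∞))).measurableSet
  rw [← integral_indicator_one hm]
  refine integral_congr_ae (Filter.Eventually.of_forall fun ω => ?_)
  by_cases h : pointCount x B ω < n <;> simp [Set.indicator, h]

/-- With $\rho$ the mean, $1-(1+\rho)e^{-\rho}\le 1-(1+\rho)(1-\rho)=\rho^2$. -/
theorem measureReal_two_le_pointCount (hP : IsPoissonProcess μ lam x) (hlam : 0 ≤ lam)
    (hx : ∀ i, Measurable (x i))
    {B : Set Plane} (hB : MeasurableSet B) (hv : volume B ≠ ∞) :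
    μ.real {ω | 2 ≤ pointCount x B ω} ≤ (lam * volume.real B) ^ 2 := by
  have hm : MeasurableSet {ω | pointCount x B ω < (2 : ℕ)} :=
    measurable_pointCount hx hB (Set.to_countable (Set.Iio ((2 : ℕ) : ℕ∞))).measurableSet
  have h1 : {ω | 2 ≤ pointCount x B ω} = {ω | pointCount x B ω < (2 : ℕ)}ᶜ := by
    ext ω
    simp only [Set.mem_compl_iff, Set.mem_ofPred_eq, not_lt]
    rfl
  rw [h1, probReal_compl_eq_one_sub hm, hP.measureReal_pointCount_lt hlam hx hB hv 2, poissonLT]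
  generalize hρ : lam * volume.real B = ρ
  have hρ0 : 0 ≤ ρ := hρ ▸ mul_nonneg hlam measureReal_nonneg
  have h2 := Real.add_one_le_exp (-ρ)
  simp only [Finset.sum_range_succ, Finset.sum_range_zero, pow_zero, pow_one, Nat.factorial]
  norm_num
  nlinarith

/-- Two equidistant points within radius $K$ share one of $K(m+1)$ annuli of width $1/(m+1)$. Each
annulus has area at most $2\pi K/(m+1)$, so it holds two points with probability $O((m+1)^{-2})$;
the sum over the annuli is $O((m+1)^{-1})$ and tends to $0$. -/
theorem ae_norm_lt_norm_succ (hP : IsPoissonProcess μ lam x) (hlam : 0 ≤ lam)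
    (hx : ∀ i, Measurable (x i)) (hord : ∀ᵐ ω ∂μ, ∀ i, 1 ≤ i → ‖x i ω‖ ≤ ‖x (i + 1) ω‖) :
    ∀ᵐ ω ∂μ, ∀ i, 1 ≤ i → ‖x i ω‖ < ‖x (i + 1) ω‖ := by
  have key : ∀ i, 1 ≤ i → ∀ K : ℕ,
      μ.real {ω | ‖x i ω‖ = ‖x (i + 1) ω‖ ∧ ‖x i ω‖ < K} = 0 := by
    intro i hi K
    have hb : ∀ m : ℕ, μ.real {ω | ‖x i ω‖ = ‖x (i + 1) ω‖ ∧ ‖x i ω‖ < K} ≤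
        (K * (lam * (Real.pi * (2 * K))) ^ 2) * ((m : ℝ) + 1)⁻¹ := by
      intro m
      have hm0 : (0 : ℝ) < m + 1 := by positivity
      let A : ℕ → Set Plane := fun l =>
        Metric.ball 0 ((l + 1 : ℝ) / (m + 1)) \ Metric.ball 0 ((l : ℝ) / (m + 1))
      have hAm : ∀ l, MeasurableSet (A l) := fun l => measurableSet_ball.diff measurableSet_ball
      have hAv : ∀ l, volume (A l) ≠ ∞ := fun l =>
        ((measure_mono Set.sdiff_subset).trans_lt measure_ball_lt_top).ne
      have hA : ∀ l, volume.real (A l) = Real.pi * (2 * l + 1) / (m + 1) ^ 2 := by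
        intro l
        rw [measureReal_sdiff (Metric.ball_subset_ball (by gcongr; linarith)) measurableSet_ball,
          volume_real_ball_plane (by positivity), volume_real_ball_plane (by positivity)]
        field_simp
        ring
      have hsub : {ω | ‖x i ω‖ = ‖x (i + 1) ω‖ ∧ ‖x i ω‖ < K} ⊆
          ⋃ l ∈ Finset.range (K * (m + 1)), {ω | 2 ≤ pointCount x (A l) ω} := by
        rintro ω ⟨h1, h2⟩
        have h3 : 0 ≤ ‖x i ω‖ * (m + 1) := by positivity
        have h4 := (Nat.floor_eq_iff h3).1 rfl
        set l := ⌊‖x i ω‖ * (m + 1)⌋₊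
        have hmem : ∀ y : Plane, ‖y‖ = ‖x i ω‖ → y ∈ A l := by
          intro y hy
          simp only [A, Set.mem_sdiff, mem_ball_zero_iff, not_lt, hy]
          exact ⟨by rw [lt_div_iff₀ hm0]; exact h4.2, by rw [div_le_iff₀ hm0]; exact h4.1⟩
        simp only [Set.mem_iUnion, Finset.mem_range, Set.mem_ofPred_eq, exists_prop]
        refine ⟨l, ?_, ?_⟩
        · have : (l : ℝ) < K * (m + 1) := lt_of_le_of_lt h4.1 (by gcongr)
          exact_mod_cast this
        · have hs : ({i, i + 1} : Set ℕ) ⊆ {j : ℕ | 1 ≤ j ∧ x j ω ∈ A l} := by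
            rintro j (rfl | rfl)
            · exact ⟨hi, hmem _ rfl⟩
            · exact ⟨by omega, hmem _ h1.symm⟩
          have := Set.encard_le_encard hs
          rwa [Set.encard_pair (by omega)] at this
      calc μ.real {ω | ‖x i ω‖ = ‖x (i + 1) ω‖ ∧ ‖x i ω‖ < K}
          ≤ ∑ l ∈ Finset.range (K * (m + 1)), μ.real {ω | 2 ≤ pointCount x (A l) ω} :=
            (measureReal_mono hsub (measure_ne_top _ _)).trans (measureReal_biUnion_finset_le _ _)
        _ ≤ ∑ l ∈ Finset.range (K * (m + 1)), (lam * (Real.pi * (2 * K)) / (m + 1)) ^ 2 := by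
            refine Finset.sum_le_sum fun l hl => ?_
            refine (hP.measureReal_two_le_pointCount hlam hx (hAm l) (hAv l)).trans ?_
            rw [hA l]
            refine pow_le_pow_left₀ (by positivity) ?_ 2
            rw [mul_div_assoc lam]
            refine mul_le_mul_of_nonneg_left ?_ hlam
            rw [mul_div_assoc, mul_div_assoc]
            refine mul_le_mul_of_nonneg_left ?_ Real.pi_pos.le
            rw [div_le_div_iff₀ (by positivity) hm0]
            have h5 : (l : ℝ) + 1 ≤ K * (m + 1) := by
              exact_mod_cast Finset.mem_range.1 hl
            nlinarith
        _ = _ := by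
            rw [Finset.sum_const, Finset.card_range, nsmul_eq_mul]
            push_cast
            field_simp
    have hlim : Filter.Tendsto (fun m : ℕ => (K * (lam * (Real.pi * (2 * K))) ^ 2) *
        ((m : ℝ) + 1)⁻¹) Filter.atTop (nhds 0) := by
      have := tendsto_one_div_add_atTop_nhds_zero_nat (𝕜 := ℝ)
      simpa using this.const_mul (K * (lam * (Real.pi * (2 * K))) ^ 2)
    exact le_antisymm (ge_of_tendsto' hlim hb) measureReal_nonneg
  have hne : ∀ᵐ ω ∂μ, ∀ i, 1 ≤ i → ∀ K : ℕ, ¬(‖x i ω‖ = ‖x (i + 1) ω‖ ∧ ‖x i ω‖ < K) := by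
    simp_rw [ae_all_iff]
    intro i hi K
    rw [ae_iff]
    simpa [measureReal_eq_zero_iff] using key i hi K
  filter_upwards [hne, hord] with ω h1 h2 i hi
  refine lt_of_le_of_ne (h2 i hi) fun h => ?_
  obtain ⟨K, hK⟩ := exists_nat_gt ‖x i ω‖
  exact h1 i hi K ⟨h, hK⟩

end IsPoissonProcess

end Poisson

/-! ### Density of the distance to the `n`-th nearest interferer. -/

/-- The derivatives of consecutive Poisson weights telescope, leaving only the last one. -/
theorem hasDerivAt_poissonLT (n : ℕ) (ρ : ℝ) :
    HasDerivAt (fun ρ => -poissonLT (n + 1) ρ) (Real.exp (-ρ) * ρ ^ n / n.factorial) ρ := by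
  induction n with
  | zero =>
    have h1 : (fun ρ => -poissonLT (0 + 1) ρ) = fun ρ => -Real.exp (-ρ) := by
      ext ρ; simp [poissonLT]
    rw [h1]
    refine (hasDerivAt_neg ρ).exp.neg.congr_deriv ?_
    simp
  | succ n ih =>
    have h1 : (fun ρ => -poissonLT (n + 1 + 1) ρ) = fun ρ => -poissonLT (n + 1) ρ +
        -(Real.exp (-ρ) * ρ ^ (n + 1) / (n + 1).factorial) := by
      ext ρ
      rw [poissonLT, Finset.sum_range_succ, poissonLT]; ring
    rw [h1]
    have h2 := ((hasDerivAt_neg ρ).exp.mul (hasDerivAt_pow (n + 1) ρ)).div_const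
      ((n + 1).factorial : ℝ)
    refine (ih.add h2.neg).congr_deriv ?_
    have : (n.factorial : ℝ) ≠ 0 := by positivity
    rw [Nat.factorial_succ]
    push_cast
    field_simp
    simp

theorem tendsto_poissonLT (n : ℕ) : Filter.Tendsto (poissonLT n) Filter.atTop (nhds 0) := by
  have : Filter.Tendsto (fun ρ => ∑ k ∈ Finset.range n, Real.exp (-ρ) * ρ ^ k / k.factorial)
      Filter.atTop (nhds (∑ k ∈ Finset.range n, (0 : ℝ) / k.factorial)) := by
    refine tendsto_finsetSum _ fun k _ => Filter.Tendsto.div_const ?_ _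
    simpa [mul_comm] using Real.tendsto_pow_mul_exp_neg_atTop_nhds_zero k
  simp only [zero_div, Finset.sum_const_zero] at this
  exact this

namespace SysParams

theorem distDensity_nonneg {p : SysParams} (hlam : 0 ≤ p.lam) {r : ℝ} (hr : 0 ≤ r) {n : ℕ} :
    0 ≤ p.distDensity r n := by
  have := Real.pi_pos
  have := Real.Gamma_nonneg_of_nonneg (Nat.cast_nonneg (α := ℝ) n)
  unfold distDensity
  positivity

theorem measurable_distDensity (p : SysParams) (n : ℕ) :
    Measurable fun r => p.distDensity r n := by
  unfold distDensity
  fun_prop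

theorem hasDerivAt_distTail (p : SysParams) (n : ℕ) (r : ℝ) :
    HasDerivAt (fun r => -poissonLT (n + 1) (p.lam * (Real.pi * r ^ 2)))
      (p.distDensity r (n + 1)) r := by
  have h1 : HasDerivAt (fun r : ℝ => p.lam * (Real.pi * r ^ 2)) (p.lam * (Real.pi * (2 * r))) r := by
    simpa using ((hasDerivAt_pow 2 r).const_mul Real.pi).const_mul p.lam
  refine ((hasDerivAt_poissonLT n _).comp r h1).congr_deriv ?_
  rw [distDensity]
  have h2 : Real.Gamma ((n + 1 : ℕ) : ℝ) = n.factorial := by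
    push_cast
    exact Real.Gamma_nat_eq_factorial n
  rw [h2, show 2 * (n + 1) - 1 = 2 * n + 1 by omega]
  ring_nf

theorem lintegral_distDensity_Ioi {p : SysParams} (hlam : 0 < p.lam) (n : ℕ) {a : ℝ}
    (ha : 0 ≤ a) :
    ∫⁻ r in Set.Ioi a, ENNReal.ofReal (p.distDensity r (n + 1)) =
      ENNReal.ofReal (poissonLT (n + 1) (p.lam * (Real.pi * a ^ 2))) := by
  have hlim : Filter.Tendsto (fun r => -poissonLT (n + 1) (p.lam * (Real.pi * r ^ 2)))
      Filter.atTop (nhds 0) := by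
    rw [← neg_zero]
    refine ((tendsto_poissonLT (n + 1)).comp ?_).neg
    exact ((Filter.tendsto_pow_atTop two_ne_zero).const_mul_atTop Real.pi_pos).const_mul_atTop hlam
  have hnn : ∀ r ∈ Set.Ioi a, 0 ≤ p.distDensity r (n + 1) := fun r hr =>
    distDensity_nonneg hlam.le (ha.trans (le_of_lt hr))
  have h1 := integral_Ioi_of_hasDerivAt_of_nonneg' (a := a)
    (fun r _ => p.hasDerivAt_distTail n r) hnn hlim
  have h2 := integrableOn_Ioi_deriv_of_nonneg' (a := a)
    (fun r _ => p.hasDerivAt_distTail n r) hnn hlim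
  rw [← ofReal_integral_eq_lintegral_ofReal h2
    ((ae_restrict_iff' measurableSet_Ioi).2 (Filter.Eventually.of_forall hnn)), h1]
  simp

end SysParams

section Distance

variable {Ω : Type*} [MeasurableSpace Ω] {μ : Measure Ω} [IsProbabilityMeasure μ]
  {p : SysParams} {x : ℕ → Ω → Plane}

/-- Both measures are compared on the half-lines $[a,\infty)$, where each gives the probability of
at most `n` points in the disc of radius $a$. Radius `max a 0` covers negative $a$. -/
theorem map_norm_eq_withDensity (hlam : 0 < p.lam) (hP : IsPoissonProcess μ p.lam x)
    (hx : ∀ i, Measurable (x i)) (hord : ∀ᵐ ω ∂μ, ∀ i, 1 ≤ i → ‖x i ω‖ ≤ ‖x (i + 1) ω‖)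
    (n : ℕ) :
    μ.map (fun ω => ‖x (n + 1) ω‖) = (volume.restrict (Set.Ioi 0)).withDensity
      fun r => ENNReal.ofReal (p.distDensity r (n + 1)) := by
  have hm : Measurable fun ω => ‖x (n + 1) ω‖ := (hx _).norm
  have : IsProbabilityMeasure (μ.map fun ω => ‖x (n + 1) ω‖) :=
    Measure.isProbabilityMeasure_map hm.aemeasurable
  refine Measure.ext_of_Ici _ _ fun a => ?_
  rw [withDensity_apply _ measurableSet_Ici, Measure.restrict_restrict measurableSet_Ici,
    Measure.map_apply hm measurableSet_Ici]
  have h1 : (Set.Ici a ∩ Set.Ioi 0 : Set ℝ) =ᵐ[volume] Set.Ioi (max a 0) := by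
    rw [← Set.Ioi_inter_Ioi]
    exact Ioi_ae_eq_Ici.symm.inter (Filter.EventuallyEq.refl _ _)
  rw [Measure.restrict_congr_set h1, SysParams.lintegral_distDensity_Ioi hlam n (le_max_right _ _),
    ← volume_real_ball_plane (le_max_right _ _),
    ← hP.measureReal_pointCount_lt hlam.le hx measurableSet_ball measure_ball_lt_top.ne,
    ofReal_measureReal]
  refine measure_congr ?_
  filter_upwards [hord] with ω hω
  refine propext ?_
  refine Iff.trans ?_ (pointCount_ball_lt_iff hω (Nat.succ_pos n) (max a 0)).symm
  change a ≤ _ ↔ _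
  simp

theorem integral_comp_norm_eq (hlam : 0 < p.lam) (hP : IsPoissonProcess μ p.lam x)
    (hx : ∀ i, Measurable (x i)) (hord : ∀ᵐ ω ∂μ, ∀ i, 1 ≤ i → ‖x i ω‖ ≤ ‖x (i + 1) ω‖)
    (n : ℕ) {G : ℝ → ℝ} (hG : Measurable G) :
    ∫ ω, G ‖x (n + 1) ω‖ ∂μ = ∫ r in Set.Ioi 0, p.distDensity r (n + 1) * G r := by
  rw [← integral_map (f := G) (hx _).norm.aemeasurable hG.aestronglyMeasurable,
    map_norm_eq_withDensity hlam hP hx hord n,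
    integral_withDensity_eq_integral_toReal_smul
      (p.measurable_distDensity _).ennreal_ofReal (Filter.Eventually.of_forall fun _ => by simp)]
  refine setIntegral_congr_fun measurableSet_Ioi fun r hr => ?_
  simp only [smul_eq_mul]
  rw [ENNReal.toReal_ofReal (SysParams.distDensity_nonneg hlam.le (le_of_lt hr))]

end Distance

/-! ### Points beyond the `n`-th nearest: conditioning by discretisation. -/

theorem integral_congr_of_setIntegral_fiber {Ω : Type*} [MeasurableSpace Ω] {μ : Measure Ω}
    {N : Ω → ℕ} (hN : Measurable N) {u v : Ω → ℝ} (hu : Integrable u μ) (hv : Integrable v μ)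
    (huv : ∀ l, ∫ ω in N ⁻¹' {l}, u ω ∂μ = ∫ ω in N ⁻¹' {l}, v ω ∂μ) :
    ∫ ω, u ω ∂μ = ∫ ω, v ω ∂μ := by
  have hU : (Set.univ : Set Ω) = ⋃ l, N ⁻¹' {l} := by ext; simp
  have hm : ∀ l, MeasurableSet (N ⁻¹' {l}) := fun l => hN (measurableSet_singleton l)
  have hd : Pairwise (Function.onFun Disjoint fun l => N ⁻¹' {l}) := fun a b hab =>
    Disjoint.preimage _ (Set.disjoint_singleton.2 hab)
  rw [← setIntegral_univ (f := u), ← setIntegral_univ (f := v), hU,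
    integral_iUnion hm hd hu.integrableOn, integral_iUnion hm hd hv.integrableOn]
  exact tsum_congr huv

/-- The exponent `log (1 + a * w y)` on the complement of the ball of radius `d`. -/
noncomputable def logWeight (w : Plane → ℝ) (a d : ℝ) : Plane → ℝ :=
  (Metric.ball 0 d)ᶜ.indicator fun y => Real.log (1 + a * w y)

section logWeight

variable {w : Plane → ℝ} {a d : ℝ}

theorem measurable_logWeight (hw : Measurable w) (a d : ℝ) : Measurable (logWeight w a d) :=
  (Real.measurable_log.comp ((hw.const_mul a).const_add 1)).indicator
    measurableSet_ball.compl

theorem logWeight_nonneg (hw0 : ∀ y, 0 ≤ w y) (ha : 0 ≤ a) (y : Plane) :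
    0 ≤ logWeight w a d y :=
  Set.indicator_nonneg (fun y _ => Real.log_nonneg (by nlinarith [mul_nonneg ha (hw0 y)])) y

theorem logWeight_le (hw0 : ∀ y, 0 ≤ w y) (ha : 0 ≤ a) (y : Plane) :
    logWeight w a d y ≤ a * w y := by
  have h0 := mul_nonneg ha (hw0 y)
  refine Set.indicator_le' (g := fun y => a * w y) (fun y _ => ?_) (fun y _ => ?_) y
  · have h0 := mul_nonneg ha (hw0 y)
    have := Real.log_le_sub_one_of_pos (show 0 < 1 + a * w y by linarith)
    linarith
  · exact mul_nonneg ha (hw0 y)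

theorem logWeight_eq_zero {y : Plane} (hy : y ∈ Metric.ball 0 d) : logWeight w a d y = 0 :=
  Set.indicator_of_notMem (by simpa using hy) _

theorem integrable_logWeight (hw : Measurable w) (hw0 : ∀ y, 0 ≤ w y) (hwi : Integrable w)
    (ha : 0 ≤ a) : Integrable (logWeight w a d) :=
  (hwi.const_mul a).mono' (measurable_logWeight hw a d).aestronglyMeasurable
    (Filter.Eventually.of_forall fun y => by
      rw [Real.norm_of_nonneg (logWeight_nonneg hw0 ha y)]; exact logWeight_le hw0 ha y)

/-- The cut-off at radius $d$ is discontinuous only on the sphere of radius $d_0$, which is excluded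
here and is a null set in `tendsto_laplaceWeight`. -/
theorem tendsto_logWeight {a d : ℕ → ℝ} {a₀ d₀ : ℝ} (ha : Filter.Tendsto a Filter.atTop (nhds a₀))
    (hd : Filter.Tendsto d Filter.atTop (nhds d₀)) (ha₀ : 0 ≤ a₀) {y : Plane}
    (hw0 : 0 ≤ w y) (hy : ‖y‖ ≠ d₀) :
    Filter.Tendsto (fun k => logWeight w (a k) (d k) y) Filter.atTop
      (nhds (logWeight w a₀ d₀ y)) := by
  rcases lt_or_gt_of_ne hy with h | h
  · refine tendsto_const_nhds.congr' ?_
    filter_upwards [hd.eventually (eventually_gt_nhds h)] with k hk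
    rw [logWeight_eq_zero (by simpa using h), logWeight_eq_zero (by simpa using hk)]
  · rw [logWeight, Set.indicator_of_mem (by simpa using h.le)]
    have h1 : Filter.Tendsto (fun k => Real.log (1 + a k * w y)) Filter.atTop
        (nhds (Real.log (1 + a₀ * w y))) :=
      (((ha.mul_const _).const_add 1)).log (by nlinarith [mul_nonneg ha₀ hw0])
    refine h1.congr' ?_
    filter_upwards [hd.eventually (eventually_lt_nhds h)] with k hk
    rw [logWeight, Set.indicator_of_mem (by simpa using hk.le)]

/-- The Laplace functional of the Poisson process at `logWeight w a d`. -/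
noncomputable def laplaceWeight (lam : ℝ) (w : Plane → ℝ) (a d : ℝ) : ℝ :=
  Real.exp (-(lam * ∫ y, (1 - Real.exp (-logWeight w a d y))))

theorem laplaceWeight_mem {lam : ℝ} (hlam : 0 ≤ lam) (hw0 : ∀ y, 0 ≤ w y) (ha : 0 ≤ a) :
    |laplaceWeight lam w a d| ≤ 1 := by
  rw [laplaceWeight, abs_of_pos (Real.exp_pos _), Real.exp_le_one_iff, neg_nonpos]
  refine mul_nonneg hlam (integral_nonneg fun y => ?_)
  have : Real.exp (-logWeight w a d y) ≤ 1 := by simpa using logWeight_nonneg hw0 ha y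
  simpa using this

theorem tendsto_laplaceWeight {lam : ℝ} (hw : Measurable w) (hw0 : ∀ y, 0 ≤ w y)
    (hwi : Integrable w) {a d : ℕ → ℝ} {a₀ d₀ : ℝ}
    (ha : Filter.Tendsto a Filter.atTop (nhds a₀)) (ha0 : ∀ k, 0 ≤ a k)
    (hd : Filter.Tendsto d Filter.atTop (nhds d₀)) :
    Filter.Tendsto (fun k => laplaceWeight lam w (a k) (d k)) Filter.atTop
      (nhds (laplaceWeight lam w a₀ d₀)) := by
  obtain ⟨M, hM⟩ := ha.bddAbove_range
  have hM' : ∀ k, a k ≤ M := fun k => hM ⟨k, rfl⟩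
  have ha₀ : 0 ≤ a₀ := ge_of_tendsto' ha ha0
  refine (Real.continuous_exp.tendsto _).comp (Filter.Tendsto.neg (Filter.Tendsto.const_mul lam ?_))
  refine tendsto_integral_of_dominated_convergence (fun y => M * w y) (fun k => ?_)
    (hwi.const_mul M) (fun k => ?_) ?_
  · exact (measurable_const.sub
      (Real.measurable_exp.comp (measurable_logWeight hw _ _).neg)).aestronglyMeasurable
  · refine Filter.Eventually.of_forall fun y => ?_
    have h1 := Real.add_one_le_exp (-logWeight w (a k) (d k) y)
    have h2 : Real.exp (-logWeight w (a k) (d k) y) ≤ 1 := by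
      simpa using logWeight_nonneg hw0 (ha0 k) y
    rw [Real.norm_of_nonneg (by linarith)]
    have h3 := logWeight_le (d := d k) hw0 (ha0 k) y
    have h4 := mul_le_mul_of_nonneg_right (hM' k) (hw0 y)
    linarith
  · have hae : ∀ᵐ y : Plane, ‖y‖ ≠ d₀ := by
      rw [ae_iff]
      have : {y : Plane | ¬‖y‖ ≠ d₀} = Metric.sphere 0 d₀ := by ext; simp
      rw [this]
      exact Measure.addHaar_sphere _ _ _
    filter_upwards [hae] with y hy
    exact ((Real.continuous_exp.tendsto _).comp
      (tendsto_logWeight ha hd ha₀ (hw0 y) hy).neg).const_sub 1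

end logWeight

section Distance

theorem measurable_exp_neg_tsum {Ω : Type*} [MeasurableSpace Ω]
    {x : ℕ → Ω → Plane} (hx : ∀ i, Measurable (x i)) {f : Plane → ℝ}
    (hfm : Measurable f) : Measurable fun ω => Real.exp (-∑' i : ℕ, f (x (i + 1) ω)) :=
  Real.measurable_exp.comp (Measurable.tsum fun _ => hfm.comp (hx _)).neg

variable {Ω : Type*} [MeasurableSpace Ω] {μ : Measure Ω} [IsProbabilityMeasure μ]
  {lam : ℝ} {x : ℕ → Ω → Plane}

/-- The event says that the ball of radius `c` holds fewer than `n` points, and `f` vanishes on that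
ball: the joint Laplace functional applies with an indicator as `ψ`. -/
theorem setIntegral_norm_ge_exp_neg_tsum (hP : IsPoissonProcess μ lam x) (hlam : 0 ≤ lam)
    (hx : ∀ i, Measurable (x i)) (hord : ∀ᵐ ω ∂μ, ∀ i, 1 ≤ i → ‖x i ω‖ ≤ ‖x (i + 1) ω‖)
    {n : ℕ} (hn : 1 ≤ n) {f : Plane → ℝ} (hfm : Measurable f) (hf0 : ∀ y, 0 ≤ f y)
    (hf : Integrable f) {c : ℝ} (hfc : ∀ y ∈ Metric.ball 0 c, f y = 0) :
    ∫ ω in {ω | c ≤ ‖x n ω‖}, Real.exp (-∑' i : ℕ, f (x (i + 1) ω)) ∂μ =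
      μ.real {ω | c ≤ ‖x n ω‖} * Real.exp (-(lam * ∫ y, (1 - Real.exp (-f y)))) := by
  have hm : MeasurableSet {ω | c ≤ ‖x n ω‖} := measurableSet_le measurable_const (hx n).norm
  have h1 := hP.integral_mul_exp_neg_tsum hlam hx hfm hf0 hf measurableSet_ball
    measure_ball_lt_top.ne hfc (ψ := fun k => if k < n then 1 else 0)
    (fun k => by split_ifs <;> simp)
  rw [← integral_indicator hm, ← integral_indicator_one hm]
  refine (integral_congr_ae ?_).trans (h1.trans ?_)
  · filter_upwards [hord] with ω hω
    by_cases h : c ≤ ‖x n ω‖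
    · rw [Set.indicator_of_mem (by exact h), if_pos ((pointCount_ball_lt_iff hω hn c).2 h), one_mul]
    · rw [Set.indicator_of_notMem (by exact h),
        if_neg (mt (pointCount_ball_lt_iff hω hn c).1 h), zero_mul]
  · congr 1
    refine integral_congr_ae ?_
    filter_upwards [hord] with ω hω
    by_cases h : c ≤ ‖x n ω‖
    · rw [Set.indicator_of_mem (by exact h), if_pos ((pointCount_ball_lt_iff hω hn c).2 h)]; rfl
    · rw [Set.indicator_of_notMem (by exact h), if_neg (mt (pointCount_ball_lt_iff hω hn c).1 h)]

theorem integrable_exp_neg_tsum (hx : ∀ i, Measurable (x i)) {f : Plane → ℝ}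
    (hfm : Measurable f) (hf0 : ∀ y, 0 ≤ f y) :
    Integrable (fun ω => Real.exp (-∑' i : ℕ, f (x (i + 1) ω))) μ := by
  refine Integrable.of_bound (C := 1) ?_ (Filter.Eventually.of_forall fun ω => ?_)
  · exact (measurable_exp_neg_tsum hx hfm).aestronglyMeasurable
  · rw [Real.norm_eq_abs, abs_of_pos (Real.exp_pos _), Real.exp_le_one_iff, neg_nonpos]
    exact tsum_nonneg fun i => hf0 _

/-- The event is a difference of two events of the preceding kind. Since `f` vanishes on the larger
ball, both carry the same exponential factor. -/
theorem setIntegral_norm_mem_Ico_exp_neg_tsum (hP : IsPoissonProcess μ lam x) (hlam : 0 ≤ lam)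
    (hx : ∀ i, Measurable (x i)) (hord : ∀ᵐ ω ∂μ, ∀ i, 1 ≤ i → ‖x i ω‖ ≤ ‖x (i + 1) ω‖)
    {n : ℕ} (hn : 1 ≤ n) {f : Plane → ℝ} (hfm : Measurable f) (hf0 : ∀ y, 0 ≤ f y)
    (hf : Integrable f) {c d : ℝ} (hcd : c ≤ d) (hfd : ∀ y ∈ Metric.ball 0 d, f y = 0) :
    ∫ ω in {ω | c ≤ ‖x n ω‖ ∧ ‖x n ω‖ < d}, Real.exp (-∑' i : ℕ, f (x (i + 1) ω)) ∂μ =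
      μ.real {ω | c ≤ ‖x n ω‖ ∧ ‖x n ω‖ < d} *
        Real.exp (-(lam * ∫ y, (1 - Real.exp (-f y)))) := by
  have hm : ∀ c, MeasurableSet {ω | c ≤ ‖x n ω‖} := fun c =>
    measurableSet_le measurable_const (hx n).norm
  have hsub : {ω | d ≤ ‖x n ω‖} ⊆ {ω | c ≤ ‖x n ω‖} := fun ω (h : d ≤ _) => hcd.trans h
  have heq : {ω | c ≤ ‖x n ω‖ ∧ ‖x n ω‖ < d} = {ω | c ≤ ‖x n ω‖} \ {ω | d ≤ ‖x n ω‖} := by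
    ext ω; simp
  rw [heq, setIntegral_sdiff (hm d) (integrable_exp_neg_tsum hx hfm hf0).integrableOn hsub,
    setIntegral_norm_ge_exp_neg_tsum hP hlam hx hord hn hfm hf0 hf hfd,
    setIntegral_norm_ge_exp_neg_tsum hP hlam hx hord hn hfm hf0 hf
      (fun y hy => hfd y (Metric.ball_subset_ball hcd hy)),
    measureReal_sdiff hsub (hm d)]
  ring

set_option maxHeartbeats 1000000 in
/-- Conditionally on the distance `r` of the `n`-th nearest point, the points farther away
form a Poisson process on the complement of the ball of radius `r`. -/
theorem integral_mul_exp_neg_tsum_beyond (hP : IsPoissonProcess μ lam x) (hlam : 0 ≤ lam)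
    (hx : ∀ i, Measurable (x i)) (hord : ∀ᵐ ω ∂μ, ∀ i, 1 ≤ i → ‖x i ω‖ ≤ ‖x (i + 1) ω‖)
    {n : ℕ} (hn : 1 ≤ n) {w : Plane → ℝ} (hw : Measurable w) (hw0 : ∀ y, 0 ≤ w y)
    (hwi : Integrable w) {s φ : ℝ → ℝ} (hs : Continuous s) (hφ : Continuous φ)
    (hs0 : ∀ r, 0 ≤ r → 0 ≤ s r) (hφ1 : ∀ r, 0 ≤ r → |φ r| ≤ 1) :
    ∫ ω, φ ‖x n ω‖ * Real.exp (-∑' i : ℕ,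
        if n ≤ i then Real.log (1 + s ‖x n ω‖ * w (x (i + 1) ω)) else 0) ∂μ =
      ∫ ω, φ ‖x n ω‖ * laplaceWeight lam w (s ‖x n ω‖) ‖x n ω‖ ∂μ := by
  -- `D k` rounds `‖x n‖` strictly upwards on the grid of mesh $1/(k+1)$. Hence the ball of radius
  -- `D k` contains the points `1, …, n`, and `logWeight` removes exactly the contributions that the
  -- statement omits, up to points that disappear in the limit.
  let N : ℕ → Ω → ℕ := fun k ω => ⌊‖x n ω‖ * (k + 1)⌋₊
  let D : ℕ → Ω → ℝ := fun k ω => ((N k ω : ℝ) + 1) / (k + 1)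
  have hN : ∀ k, Measurable (N k) := fun k => Nat.measurable_floor.comp ((hx n).norm.mul_const _)
  have hD0 : ∀ k ω, 0 ≤ D k ω := fun k ω => by positivity
  have hDlt : ∀ k ω, ‖x n ω‖ < D k ω := fun k ω => by
    rw [lt_div_iff₀ (by positivity)]
    exact Nat.lt_floor_add_one _
  have hDle : ∀ k ω, D k ω ≤ ‖x n ω‖ + 1 / (k + 1) := fun k ω => by
    have : (N k ω : ℝ) ≤ ‖x n ω‖ * (k + 1) := Nat.floor_le (by positivity)
    simp only [D]
    rw [div_le_iff₀ (by positivity)]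
    field_simp
    linarith
  have hDlim : ∀ ω, Filter.Tendsto (fun k => D k ω) Filter.atTop (nhds ‖x n ω‖) := fun ω => by
    refine tendsto_of_tendsto_of_tendsto_of_le_of_le tendsto_const_nhds ?_
      (fun k => (hDlt k ω).le) (fun k => hDle k ω)
    simpa using tendsto_one_div_add_atTop_nhds_zero_nat.const_add ‖x n ω‖
  let u : ℕ → Ω → ℝ := fun k ω => φ (D k ω) *
    Real.exp (-∑' i : ℕ, logWeight w (s (D k ω)) (D k ω) (x (i + 1) ω))
  let v : ℕ → Ω → ℝ := fun k ω => φ (D k ω) * laplaceWeight lam w (s (D k ω)) (D k ω)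
  have hsD : ∀ k ω, 0 ≤ s (D k ω) := fun k ω => hs0 _ (hD0 k ω)
  have hum : ∀ k, Measurable (u k) := fun k => by
    -- `D k` takes countably many values, so measurability need only be checked for each fixed
    -- radius.
    have h1 : Measurable fun q : ℕ × Ω => φ ((q.1 + 1) / (k + 1)) *
        Real.exp (-∑' i : ℕ, logWeight w (s ((q.1 + 1) / (k + 1))) ((q.1 + 1) / (k + 1))
          (x (i + 1) q.2)) := by
      refine measurable_from_prod_countable_right fun l => ?_
      exact (measurable_exp_neg_tsum hx (measurable_logWeight hw (s ((l + 1) / (k + 1)))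
        ((l + 1) / (k + 1)))).const_mul (φ ((l + 1) / (k + 1)))
    exact h1.comp ((hN k).prodMk measurable_id)
  have hvm : ∀ k, Measurable (v k) := fun k => by
    have h1 : Measurable fun l : ℕ => φ ((l + 1) / (k + 1)) *
      laplaceWeight lam w (s ((l + 1) / (k + 1))) ((l + 1) / (k + 1)) := measurable_from_top
    exact h1.comp (hN k)
  have hu1 : ∀ k ω, ‖u k ω‖ ≤ 1 := fun k ω => by
    rw [Real.norm_eq_abs, abs_mul, abs_of_pos (Real.exp_pos _)]
    refine mul_le_one₀ (hφ1 _ (hD0 k ω)) (Real.exp_nonneg _) ?_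
    rw [Real.exp_le_one_iff, neg_nonpos]
    exact tsum_nonneg fun i => logWeight_nonneg hw0 (hsD k ω) _
  have hv1 : ∀ k ω, ‖v k ω‖ ≤ 1 := fun k ω => by
    rw [Real.norm_eq_abs, abs_mul]
    exact mul_le_one₀ (hφ1 _ (hD0 k ω)) (abs_nonneg _) (laplaceWeight_mem hlam hw0 (hsD k ω))
  have huv : ∀ k, ∫ ω, u k ω ∂μ = ∫ ω, v k ω ∂μ := by
    intro k
    refine integral_congr_of_setIntegral_fiber (hN k)
      (Integrable.of_bound (hum k).aestronglyMeasurable 1 (Filter.Eventually.of_forall (hu1 k)))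
      (Integrable.of_bound (hvm k).aestronglyMeasurable 1 (Filter.Eventually.of_forall (hv1 k)))
      fun l => ?_
    have hk : (0 : ℝ) < k + 1 := by positivity
    set d : ℝ := (l + 1) / (k + 1) with hd
    have hd0 : 0 ≤ d := by positivity
    have hset : N k ⁻¹' {l} = {ω | (l : ℝ) / (k + 1) ≤ ‖x n ω‖ ∧ ‖x n ω‖ < d} := by
      ext ω
      simp only [Set.mem_preimage, Set.mem_singleton_iff, N, Set.mem_ofPred_eq]
      rw [Nat.floor_eq_iff (by positivity), div_le_iff₀ hk, hd, lt_div_iff₀ hk]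
    have hDd : ∀ ω ∈ N k ⁻¹' {l}, D k ω = d := fun ω hω => by
      simp only [D, hd]
      rw [show N k ω = l from hω]
    have h1 : ∫ ω in N k ⁻¹' {l}, u k ω ∂μ = ∫ ω in N k ⁻¹' {l}, φ d *
        Real.exp (-∑' i : ℕ, logWeight w (s d) d (x (i + 1) ω)) ∂μ :=
      setIntegral_congr_fun (hN k (measurableSet_singleton l)) fun ω hω => by
        simp only [u, hDd ω hω]
    have h2 : ∫ ω in N k ⁻¹' {l}, v k ω ∂μ = ∫ ω in N k ⁻¹' {l}, φ d *
        laplaceWeight lam w (s d) d ∂μ :=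
      setIntegral_congr_fun (hN k (measurableSet_singleton l)) fun ω hω => by
        simp only [v, hDd ω hω]
    rw [h1, h2, integral_const_mul, hset, setIntegral_norm_mem_Ico_exp_neg_tsum hP hlam hx hord hn
      (measurable_logWeight hw _ _) (logWeight_nonneg hw0 (hs0 d hd0))
      (integrable_logWeight hw hw0 hwi (hs0 d hd0)) (by rw [hd]; gcongr; linarith)
      (fun y hy => logWeight_eq_zero hy), setIntegral_const, smul_eq_mul, laplaceWeight]
    ring
  have hlimv : Filter.Tendsto (fun k => ∫ ω, v k ω ∂μ) Filter.atTop
      (nhds (∫ ω, φ ‖x n ω‖ * laplaceWeight lam w (s ‖x n ω‖) ‖x n ω‖ ∂μ)) := by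
    refine tendsto_integral_of_dominated_convergence (fun _ => 1)
      (fun k => (hvm k).aestronglyMeasurable) (integrable_const _)
      (fun k => Filter.Eventually.of_forall (hv1 k)) (Filter.Eventually.of_forall fun ω => ?_)
    exact ((hφ.tendsto _).comp (hDlim ω)).mul
      (tendsto_laplaceWeight hw hw0 hwi ((hs.tendsto _).comp (hDlim ω)) (fun k => hsD k ω)
        (hDlim ω))
  have hlimu : Filter.Tendsto (fun k => ∫ ω, u k ω ∂μ) Filter.atTop
      (nhds (∫ ω, φ ‖x n ω‖ * Real.exp (-∑' i : ℕ,
        if n ≤ i then Real.log (1 + s ‖x n ω‖ * w (x (i + 1) ω)) else 0) ∂μ)) := by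
    refine tendsto_integral_of_dominated_convergence (fun _ => 1)
      (fun k => (hum k).aestronglyMeasurable) (integrable_const _)
      (fun k => Filter.Eventually.of_forall (hu1 k)) ?_
    -- Without ties, each point with index above `n` is strictly farther than `x n`, so it lies
    -- outside the ball of radius `D k` for large `k` and its term converges.
    filter_upwards [hP.ae_norm_lt_norm_succ hlam hx hord, hP.ae_summable hx hw hw0 hwi]
      with ω hω hsum
    have hmono : ∀ i j, 1 ≤ i → i < j → ‖x i ω‖ < ‖x j ω‖ := by
      intro i j hi hij
      induction j, hij using Nat.le_induction with
      | base => exact hω i hi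
      | succ j hj ih => exact ih.trans (hω j (by omega))
    have hslim : Filter.Tendsto (fun k => s (D k ω)) Filter.atTop (nhds (s ‖x n ω‖)) :=
      (hs.tendsto _).comp (hDlim ω)
    refine ((hφ.tendsto _).comp (hDlim ω)).mul ((Real.continuous_exp.tendsto _).comp
      (Filter.Tendsto.neg ?_))
    obtain ⟨M, hM⟩ := hslim.bddAbove_range
    have hM' : ∀ k, s (D k ω) ≤ M := fun k => hM ⟨k, rfl⟩
    refine tendsto_tsum_of_dominated_convergence (hsum.mul_left M) (fun i => ?_)
      (Filter.Eventually.of_forall fun k i => ?_)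
    · by_cases hi : n ≤ i
      · have hlt := hmono n (i + 1) hn (by omega)
        have h1 := tendsto_logWeight (w := w) hslim (hDlim ω) (hs0 _ (norm_nonneg _))
          (hw0 (x (i + 1) ω)) hlt.ne'
        rwa [logWeight, Set.indicator_of_mem (by simpa using hlt.le), ← if_pos (c := n ≤ i)
          (t := Real.log (1 + s ‖x n ω‖ * w (x (i + 1) ω))) (e := 0) hi] at h1
      · rw [if_neg hi]
        refine tendsto_const_nhds.congr fun k => ?_
        have hle : ‖x (i + 1) ω‖ ≤ ‖x n ω‖ := by
          rcases Nat.lt_or_ge (i + 1) n with h | h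
          · exact (hmono _ _ (by omega) h).le
          · rw [show i + 1 = n by omega]
        rw [logWeight_eq_zero]
        simpa using hle.trans_lt (hDlt k ω)
    · rw [Real.norm_of_nonneg (logWeight_nonneg hw0 (hsD k ω) _)]
      exact (logWeight_le hw0 (hsD k ω) _).trans (mul_le_mul_of_nonneg_right (hM' k) (hw0 _))
  simp_rw [huv] at hlimu
  exact tendsto_nhds_unique hlimu hlimv

end Distance

/-! ### The radial integrals: cosecant and hypergeometric function. -/

theorem integrableOn_rpow_mul_exp_neg_mul_Ioi {b c : ℝ} (hb : 0 < b) (hc : 0 < c) :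
    IntegrableOn (fun t : ℝ => t ^ (b - 1) * Real.exp (-(c * t))) (Set.Ioi 0) := by
  by_contra h
  have h1 := Real.integral_rpow_mul_exp_neg_mul_Ioi hb hc
  rw [integral_undef h] at h1
  have h2 := Real.Gamma_pos_of_pos hb
  have : 0 < (1 / c) ^ b * Real.Gamma b := by positivity
  exact this.ne h1

theorem lintegral_rpow_mul_exp_neg_mul_Ioi {b c : ℝ} (hb : 0 < b) (hc : 0 < c) :
    ∫⁻ t in Set.Ioi (0 : ℝ), ENNReal.ofReal (t ^ (b - 1) * Real.exp (-(c * t))) =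
      ENNReal.ofReal ((1 / c) ^ b * Real.Gamma b) := by
  rw [← Real.integral_rpow_mul_exp_neg_mul_Ioi hb hc, ofReal_integral_eq_lintegral_ofReal
    (integrableOn_rpow_mul_exp_neg_mul_Ioi hb hc)]
  refine (ae_restrict_iff' measurableSet_Ioi).2 (Filter.Eventually.of_forall fun t ht => ?_)
  have : (0 : ℝ) < t := ht
  positivity

/-- Writing $(c+y)^{-1}=\int_0^\infty e^{-(c+y)t}\,dt$ and exchanging the integrals by Tonelli
leaves $c^{b-1}\Gamma(b)\Gamma(1-b)$, to which Euler's reflection formula applies. -/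
theorem integral_rpow_div_add_Ioi {b c : ℝ} (hb0 : 0 < b) (hb1 : b < 1) (hc : 0 < c) :
    ∫ y in Set.Ioi (0 : ℝ), y ^ (b - 1) / (c + y) =
      c ^ (b - 1) * (Real.pi / Real.sin (Real.pi * b)) := by
  rw [← Real.Gamma_mul_Gamma_one_sub]
  have hG := Real.Gamma_pos_of_pos hb0
  have hG' := Real.Gamma_pos_of_pos (sub_pos.2 hb1)
  have hnn : ∀ y ∈ Set.Ioi (0 : ℝ), 0 ≤ y ^ (b - 1) / (c + y) := fun y hy => by
    have : (0 : ℝ) < y := hy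
    positivity
  have hmeas : Measurable fun y : ℝ => y ^ (b - 1) / (c + y) := by fun_prop
  rw [integral_eq_lintegral_of_nonneg_ae
    ((ae_restrict_iff' measurableSet_Ioi).2 (Filter.Eventually.of_forall hnn))
    hmeas.aestronglyMeasurable]
  have h1 : ∀ y ∈ Set.Ioi (0 : ℝ), ENNReal.ofReal (y ^ (b - 1) / (c + y)) =
      ∫⁻ t in Set.Ioi (0 : ℝ), ENNReal.ofReal (y ^ (b - 1) * Real.exp (-((c + y) * t))) := by
    intro y hy
    have hy' : (0 : ℝ) < y := hy
    have h2 := lintegral_rpow_mul_exp_neg_mul_Ioi one_pos (show 0 < c + y by positivity)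
    simp only [sub_self, Real.rpow_zero, one_mul, Real.rpow_one, Real.Gamma_one, mul_one] at h2
    simp_rw [ENNReal.ofReal_mul (Real.rpow_nonneg hy'.le (b - 1))]
    rw [lintegral_const_mul _ (by fun_prop), h2, ← ENNReal.ofReal_mul (by positivity)]
    congr 1
    ring
  rw [setLIntegral_congr_fun measurableSet_Ioi h1, lintegral_lintegral_swap (by fun_prop)]
  have h3 : ∀ t ∈ Set.Ioi (0 : ℝ),
      ∫⁻ y in Set.Ioi (0 : ℝ), ENNReal.ofReal (y ^ (b - 1) * Real.exp (-((c + y) * t))) =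
      ENNReal.ofReal (Real.Gamma b) * ENNReal.ofReal (t ^ (1 - b - 1) * Real.exp (-(c * t))) := by
    intro t ht
    have ht' : (0 : ℝ) < t := ht
    have h4 := lintegral_rpow_mul_exp_neg_mul_Ioi hb0 ht'
    have h5 : ∀ y : ℝ, ENNReal.ofReal (y ^ (b - 1) * Real.exp (-((c + y) * t))) =
        ENNReal.ofReal (Real.exp (-(c * t))) *
          ENNReal.ofReal (y ^ (b - 1) * Real.exp (-(t * y))) := by
      intro y
      rw [← ENNReal.ofReal_mul (Real.exp_nonneg _)]
      congr 1
      rw [show -((c + y) * t) = -(c * t) + -(t * y) by ring, Real.exp_add]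
      ring
    simp_rw [h5]
    rw [lintegral_const_mul _ (by fun_prop), h4, ← ENNReal.ofReal_mul (by positivity),
      ← ENNReal.ofReal_mul hG.le]
    congr 1
    rw [one_div, Real.inv_rpow ht'.le, ← Real.rpow_neg ht'.le, show 1 - b - 1 = -b by ring]
    ring
  rw [setLIntegral_congr_fun measurableSet_Ioi h3, lintegral_const_mul _ (by fun_prop),
    lintegral_rpow_mul_exp_neg_mul_Ioi (sub_pos.2 hb1) hc, ← ENNReal.ofReal_mul hG.le,
    ENNReal.toReal_ofReal (by positivity), one_div, Real.inv_rpow hc.le, ← Real.rpow_neg hc.le]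
  rw [neg_sub]
  ring

/-- Substitution $y=u^\alpha$ with $b=2/\alpha$; the hypothesis $\alpha>2$ is exactly $b<1$. -/
theorem integral_id_div_add_rpow_Ioi {α c : ℝ} (hα : 2 < α) (hc : 0 < c) :
    ∫ u in Set.Ioi (0 : ℝ), u / (c + u ^ α) =
      c ^ (2 / α - 1) * (Real.pi / Real.sin (2 * Real.pi / α)) / α := by
  have hα0 : 0 < α := by linarith
  have h1 := integral_rpow_div_add_Ioi (b := 2 / α) (by positivity)
    (by rw [div_lt_one hα0]; exact hα) hc
  rw [show Real.pi * (2 / α) = 2 * Real.pi / α by ring] at h1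
  rw [← h1, ← integral_comp_rpow_Ioi_of_pos (g := fun y => y ^ (2 / α - 1) / (c + y)) hα0,
    ← integral_div]
  refine setIntegral_congr_fun measurableSet_Ioi fun u hu => ?_
  have hu' : (0 : ℝ) < u := hu
  have h2 : (u ^ α) ^ (2 / α - 1) = u ^ (2 - α) := by
    rw [← Real.rpow_mul hu'.le]
    congr 1
    field_simp
  have h3 : u ^ (α - 1) * u ^ (2 - α) = u := by
    rw [← Real.rpow_add hu']
    ring_nf
    exact Real.rpow_one u
  simp only [smul_eq_mul]
  rw [h2]
  have h4 : 0 < c + u ^ α := by positivity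
  field_simp
  linarith

/-- When the third parameter is $b+1$, the factor $(1-t)^{c-b-1}$ is trivial and the Gamma quotient
reduces to $b$. -/
theorem gaussHypergeometric_one_succ {b z : ℝ} (hb : 0 < b) :
    gaussHypergeometric 1 b (b + 1) z =
      b * ∫ t in Set.Ioo (0 : ℝ) 1, t ^ (b - 1) * (1 - z * t)⁻¹ := by
  rw [gaussHypergeometric, intervalIntegral.integral_of_le zero_le_one, integral_Ioc_eq_integral_Ioo,
    Real.Gamma_add_one hb.ne', show b + 1 - b = 1 by ring, Real.Gamma_one, mul_one,
    mul_div_cancel_right₀ _ (Real.Gamma_pos_of_pos hb).ne']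
  simp [Real.rpow_neg_one]

theorem image_mul_rpow_neg_Ioi {α r : ℝ} (hα : 0 < α) (hr : 0 < r) :
    (fun u : ℝ => r ^ α * u ^ (-α)) '' Set.Ioi r = Set.Ioo 0 1 := by
  ext t
  constructor
  · rintro ⟨u, hu, rfl⟩
    have hu' : r < u := hu
    have hu0 : 0 < u := hr.trans hu'
    refine ⟨by positivity, ?_⟩
    simp only
    rw [Real.rpow_neg hu0.le, ← div_eq_mul_inv, div_lt_one (by positivity)]
    exact Real.rpow_lt_rpow hr.le hu' hα
  · rintro ⟨h0, h1⟩
    refine ⟨r * t ^ (-α⁻¹), ?_, ?_⟩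
    · have : 1 < t ^ (-α⁻¹) :=
        Real.one_lt_rpow_of_pos_of_lt_one_of_neg h0 h1 (by simpa using hα)
      exact lt_mul_of_one_lt_right hr this
    · simp only
      rw [Real.mul_rpow hr.le (by positivity), ← Real.rpow_mul h0.le, ← mul_assoc,
        ← Real.rpow_add hr]
      simp [hα.ne']

/-- Substitution $t=(r/u)^\alpha$, which maps $(r,\infty)$ onto $(0,1)$. -/
theorem integral_id_div_add_rpow_Ioi_eq_hypergeometric {α a r : ℝ} (hα : 2 < α) (ha : 0 ≤ a)
    (hr : 0 < r) :
    ∫ u in Set.Ioi r, u / (1 + a + u ^ α) = r ^ (2 - α) / (α - 2) *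
      gaussHypergeometric 1 (1 - 2 / α) (2 - 2 / α) (-(1 + a) / r ^ α) := by
  have hα0 : 0 < α := by linarith
  have hb : 0 < 1 - 2 / α := by rw [sub_pos, div_lt_one hα0]; exact hα
  rw [show 2 - 2 / α = 1 - 2 / α + 1 by ring, gaussHypergeometric_one_succ hb,
    ← image_mul_rpow_neg_Ioi hα0 hr]
  have hderiv : ∀ u ∈ Set.Ioi r, HasDerivWithinAt (fun u : ℝ => r ^ α * u ^ (-α))
      (r ^ α * (-α * u ^ (-α - 1))) (Set.Ioi r) u := fun u hu =>
    ((Real.hasDerivAt_rpow_const (Or.inl (hr.trans hu).ne')).const_mul _).hasDerivWithinAt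
  have hinj : Set.InjOn (fun u : ℝ => r ^ α * u ^ (-α)) (Set.Ioi r) := by
    intro u hu u' hu' h
    have h1 := mul_left_cancel₀ (by positivity) h
    exact (Real.rpow_left_inj (hr.trans hu).le (hr.trans hu').le (by linarith)).1 h1
  rw [integral_image_eq_integral_abs_deriv_smul measurableSet_Ioi hderiv hinj,
    ← mul_assoc, ← integral_const_mul]
  refine setIntegral_congr_fun measurableSet_Ioi fun u hu => ?_
  have hu0 : 0 < u := hr.trans hu
  have h1 : |r ^ α * (-α * u ^ (-α - 1))| = α * r ^ α * u ^ (-α - 1) := by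
    rw [abs_mul, abs_mul, abs_neg, abs_of_pos hα0, abs_of_pos (by positivity),
      abs_of_pos (by positivity)]
    ring
  have h2 : (r ^ α * u ^ (-α)) ^ (1 - 2 / α - 1) = (r ^ 2)⁻¹ * u ^ 2 := by
    rw [Real.mul_rpow (by positivity) (by positivity), ← Real.rpow_mul hr.le,
      ← Real.rpow_mul hu0.le, show α * (1 - 2 / α - 1) = -2 by field_simp; ring,
      show -α * (1 - 2 / α - 1) = 2 by field_simp; ring, Real.rpow_neg hr.le]
    norm_num
  have h3 : 1 - -(1 + a) / r ^ α * (r ^ α * u ^ (-α)) = (1 + a + u ^ α) / u ^ α := by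
    rw [Real.rpow_neg hu0.le]
    field_simp
    ring
  have h4 : u ^ (-α - 1) = (u ^ α)⁻¹ * u⁻¹ := by
    rw [← Real.rpow_neg hu0.le, ← Real.rpow_neg_one, ← Real.rpow_add hu0]; rfl
  have h5 : r ^ (2 - α) = r ^ 2 / r ^ α := by
    rw [Real.rpow_sub hr]; norm_num
  simp only [smul_eq_mul]
  rw [h1, h2, h3, h4, h5]
  have h6 : 0 < 1 + a + u ^ α := by positivity
  have h7 : 0 < r ^ α := by positivity
  have h8 : 0 < u ^ α := by positivity
  have h9 : α - 2 ≠ 0 := by linarith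
  field_simp

/-! ### Path loss and its Laplace functional. -/

/-- The path loss `1 / (1 + ‖y‖ ^ α)` from the point `y` to the origin. -/
noncomputable def pathLoss (α : ℝ) (y : Plane) : ℝ := (1 + ‖y‖ ^ α)⁻¹

theorem pathLoss_nonneg (α : ℝ) (y : Plane) : 0 ≤ pathLoss α y := by
  unfold pathLoss; positivity

theorem measurable_pathLoss (α : ℝ) : Measurable (pathLoss α) := by
  unfold pathLoss; fun_prop

/-- Comparison with $(1+\|y\|)^{-\alpha}$, integrable because $\alpha$ exceeds the dimension,
through $(1+r)^\alpha\le 2^\alpha(1+r^\alpha)$. -/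
theorem integrable_pathLoss {α : ℝ} (hα : 2 < α) : Integrable (pathLoss α) := by
  have h1 : Integrable fun y : Plane => (2 : ℝ) ^ α * (1 + ‖y‖) ^ (-α) :=
    (integrable_one_add_norm (by simpa using hα)).const_mul _
  refine h1.mono' (measurable_pathLoss α).aestronglyMeasurable (Filter.Eventually.of_forall fun y => ?_)
  rw [Real.norm_of_nonneg (pathLoss_nonneg α y), pathLoss, Real.rpow_neg (by positivity),
    ← div_eq_mul_inv, inv_eq_one_div, div_le_div_iff₀ (by positivity) (by positivity), one_mul]
  have hα0 : 0 ≤ α := by linarith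
  rcases le_total ‖y‖ 1 with h | h
  · calc (1 + ‖y‖) ^ α ≤ 2 ^ α := Real.rpow_le_rpow (by positivity) (by linarith) hα0
      _ ≤ 2 ^ α * (1 + ‖y‖ ^ α) := le_mul_of_one_le_right (by positivity)
          (le_add_of_nonneg_right (by positivity))
  · calc (1 + ‖y‖) ^ α ≤ (2 * ‖y‖) ^ α := Real.rpow_le_rpow (by positivity) (by linarith) hα0
      _ = 2 ^ α * ‖y‖ ^ α := Real.mul_rpow (by norm_num) (by positivity)
      _ ≤ 2 ^ α * (1 + ‖y‖ ^ α) := by gcongr; linarith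

/-- Outside the ball the integrand is $1-(1+a\,w(y))^{-1}=a/(1+a+\|y\|^\alpha)$, a radial function,
so polar coordinates apply. -/
theorem laplaceWeight_pathLoss (lam : ℝ) {α a d : ℝ} (ha : 0 ≤ a) (hd : 0 ≤ d) :
    laplaceWeight lam (pathLoss α) a d =
      Real.exp (-(lam * (2 * Real.pi * (a * ∫ u in Set.Ioi d, u / (1 + a + u ^ α))))) := by
  have h1 : ∀ y : Plane, 1 - Real.exp (-logWeight (pathLoss α) a d y) =
      (Set.Ici d).indicator (fun u : ℝ => a / (1 + a + u ^ α)) ‖y‖ := by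
    intro y
    by_cases h : d ≤ ‖y‖
    · have h2 : (0 : ℝ) < 1 + ‖y‖ ^ α := by positivity
      rw [logWeight, Set.indicator_of_mem (by simpa using h), Set.indicator_of_mem (by exact h),
        Real.exp_neg, Real.exp_log (by have := pathLoss_nonneg α y; positivity), pathLoss]
      have h3 : (0 : ℝ) < 1 + a + ‖y‖ ^ α := by positivity
      have h4 : 1 + a * (1 + ‖y‖ ^ α)⁻¹ = (1 + a + ‖y‖ ^ α) / (1 + ‖y‖ ^ α) := by
        field_simp; ring
      rw [h4, inv_div]
      field_simp
      ring
    · rw [logWeight_eq_zero (by simpa using h), Set.indicator_of_notMem (by exact h)]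
      simp
  rw [laplaceWeight]
  simp_rw [h1]
  rw [integral_fun_norm_addHaar volume
    ((Set.Ici d).indicator fun u : ℝ => a / (1 + a + u ^ α)), volume_real_ball_plane zero_le_one]
  have h2 : ∫ u in Set.Ioi (0 : ℝ), u ^ (Module.finrank ℝ Plane - 1) •
      (Set.Ici d).indicator (fun u : ℝ => a / (1 + a + u ^ α)) u =
      a * ∫ u in Set.Ioi d, u / (1 + a + u ^ α) := by
    rw [← integral_const_mul, ← integral_Ici_eq_integral_Ioi (x := d),
      ← integral_indicator measurableSet_Ici, ← integral_indicator measurableSet_Ioi]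
    refine integral_congr_ae ?_
    filter_upwards [compl_mem_ae_iff.2 (measure_singleton (0 : ℝ))] with u hu
    have hu0 : u ≠ 0 := hu
    by_cases h : d ≤ u
    · rw [Set.indicator_of_mem (by exact lt_of_le_of_ne (hd.trans h) hu0.symm),
        Set.indicator_of_mem (by exact h), Set.indicator_of_mem (by exact h)]
      simp
      ring
    · simp [Set.indicator, h]
  rw [h2]
  simp only [finrank_euclideanSpace_fin, nsmul_eq_mul, smul_eq_mul]
  push_cast
  ring_nf

theorem laplaceWeight_pathLoss_eq_interfFactor {p : SysParams} (hα : 2 < p.alpha) {a d : ℝ}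
    (ha : 0 ≤ a) (hd : 0 < d) :
    laplaceWeight p.lam (pathLoss p.alpha) a d = p.interfFactor a d := by
  rw [laplaceWeight_pathLoss _ ha hd.le, integral_id_div_add_rpow_Ioi_eq_hypergeometric hα ha hd,
    SysParams.interfFactor]
  congr 1
  ring

theorem laplaceWeight_pathLoss_zero (lam : ℝ) {α a : ℝ} (hα : 2 < α) (ha : 0 ≤ a) :
    laplaceWeight lam (pathLoss α) a 0 =
      Real.exp (-(2 * Real.pi ^ 2 * lam / α) * a * (1 + a) ^ (2 / α - 1) *
        (1 / Real.sin (2 * Real.pi / α))) := by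
  rw [laplaceWeight_pathLoss _ ha le_rfl, integral_id_div_add_rpow_Ioi hα (by positivity)]
  congr 1
  ring

/-! ### Success probabilities of the single decodings. -/

theorem tsum_ite_lt {g : ℕ → ℝ} (hg : Summable g) (n : ℕ) :
    ∑' i, (if n < i then g i else 0) = ∑' i, g (n + 1 + i) := by
  have hs : Summable fun i => if n < i then g i else 0 := by
    refine (hg.indicator {i | n < i}).congr fun i => ?_
    simp [Set.indicator]
  rw [← hs.sum_add_tsum_nat_add (n + 1), Finset.sum_eq_zero, zero_add]
  · refine tsum_congr fun i => ?_
    rw [if_pos (by omega), add_comm]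
  · intro i hi
    rw [if_neg]
    simpa [Nat.lt_succ_iff] using hi

theorem rxPower_eq {Ω : Type*} (p : SysParams) (x : ℕ → Ω → Plane) (h : ℕ → Ω → ℝ) (i : ℕ)
    (ω : Ω) : rxPower p x h i ω = pathLoss p.alpha (x i ω) * h i ω := by
  rw [rxPower, pathLoss, div_eq_mul_inv, mul_comm]

namespace SysParams

/-- The noise power normalised by the transmit power. -/
noncomputable def noise (p : SysParams) (v : ℝ) : ℝ := p.sigma2 / p.Pt + p.sigmaC2 / (v * p.Pt)

variable {p : SysParams} {v : ℝ}

theorem Valid.noise_nonneg (hp : p.Valid) (hv : 0 < v) : 0 ≤ p.noise v := by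
  have := hp.sigma2_nonneg
  have := hp.sigmaC2_nonneg
  have := hp.Pt_pos
  unfold noise
  positivity

theorem Valid.tau_pos (hp : p.Valid) : 0 < p.tau := by
  have := hp.d0_nonneg
  unfold tau
  positivity

theorem noiseFactor_eq (hp : p.Valid) (hv : 0 < v) (s : ℝ) :
    p.noiseFactor v s = Real.exp (-(s * p.noise v)) := by
  have := hp.Pt_pos
  rw [noiseFactor, noise]
  congr 1
  field_simp

/-- Positive interference keeps the denominator positive even without noise, which excludes the
convention that division by zero gives `0`. -/
theorem le_sinr_iff (hp : p.Valid) (hv : 0 < v) {t : ℝ × ℝ} (ht : 0 < t.2) :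
    p.theta ≤ sinr p v t ↔ p.theta * (p.noise v + t.2) ≤ t.1 := by
  have hP := hp.Pt_pos
  have h0 := hp.noise_nonneg hv
  have h1 : v * (p.sigma2 + p.Pt * t.2) + p.sigmaC2 = v * p.Pt * (p.noise v + t.2) := by
    rw [noise]; field_simp; ring
  rw [sinr, h1, mul_div_mul_left _ _ (by positivity), le_div_iff₀ (by positivity)]

end SysParams

section Network

variable {Ω : Type*} [MeasurableSpace Ω] {μ : Measure Ω}
  {p : SysParams} {x : ℕ → Ω → Plane} {h : ℕ → Ω → ℝ} {v : ℝ}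

namespace IsBipolarNetwork

theorem ae_rxPower_zero (hnet : IsBipolarNetwork μ p x h) :
    ∀ᵐ ω ∂μ, rxPower p x h 0 ω = p.tau⁻¹ * h 0 ω := by
  filter_upwards [hnet.norm_zero] with ω hω
  rw [rxPower, hω, SysParams.tau, div_eq_mul_inv, mul_comm]

variable [IsProbabilityMeasure μ]

theorem ae_summable_pathLoss (hnet : IsBipolarNetwork μ p x h) (hp : p.Valid) :
    ∀ᵐ ω ∂μ, Summable fun i => pathLoss p.alpha (x i ω) := by
  filter_upwards [hnet.poisson.ae_summable hnet.measurable_pos (measurable_pathLoss p.alpha)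
    (pathLoss_nonneg p.alpha) (integrable_pathLoss hp.two_lt_alpha)] with ω hω
  exact (summable_nat_add_iff 1).1 hω

/-- Fading is independent of position and has bounded mean, so the expected sum is controlled by
Campbell's formula for the integrable path loss. The single term of index `0` does not affect
summability. -/
theorem ae_summable_rxPower (hnet : IsBipolarNetwork μ p x h) (hp : p.Valid) :
    ∀ᵐ ω ∂μ, Summable fun i => rxPower p x h i ω := by
  have hw := (measurable_pathLoss p.alpha).ennreal_ofReal
  have hfin : ∫⁻ ω, ∑' i : ℕ, ENNReal.ofReal (pathLoss p.alpha (x (i + 1) ω)) *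
      ENNReal.ofReal (h (i + 1) ω) ∂μ ≠ ∞ := by
    rw [lintegral_tsum (f := fun i ω => ENNReal.ofReal (pathLoss p.alpha (x (i + 1) ω)) *
      ENNReal.ofReal (h (i + 1) ω)) fun i => ((hw.comp (hnet.measurable_pos _)).mul
        (hnet.measurable_fading _).ennreal_ofReal).aemeasurable]
    refine ne_top_of_le_ne_top (b := ∑' i : ℕ,
      (∫⁻ ω, ENNReal.ofReal (pathLoss p.alpha (x (i + 1) ω)) ∂μ) * 4) ?_ ?_
    · rw [ENNReal.tsum_mul_right, ← lintegral_tsum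
        (f := fun i ω => ENNReal.ofReal (pathLoss p.alpha (x (i + 1) ω)))
        fun i => (hw.comp (hnet.measurable_pos _)).aemeasurable,
        hnet.poisson.lintegral_tsum_eq hnet.measurable_pos hw,
        ← ofReal_integral_eq_lintegral_ofReal (integrable_pathLoss hp.two_lt_alpha)
          (Filter.Eventually.of_forall (pathLoss_nonneg _))]
      exact ENNReal.mul_ne_top (ENNReal.mul_ne_top (by simp) (by simp)) (by simp)
    · refine ENNReal.tsum_le_tsum fun i => ?_
      have hind : IndepFun (fun ω => ENNReal.ofReal (pathLoss p.alpha (x (i + 1) ω)))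
          (fun ω => ENNReal.ofReal (h (i + 1) ω)) μ :=
        (hnet.fading_indep_pos.comp (φ := fun e : ℕ → ℝ => ENNReal.ofReal (e (i + 1)))
          (ψ := fun e : ℕ → Plane => ENNReal.ofReal (pathLoss p.alpha (e (i + 1))))
          (measurable_pi_apply _).ennreal_ofReal (hw.comp (measurable_pi_apply _))).symm
      refine (lintegral_mul_eq_lintegral_mul_lintegral_of_indepFun
        (hw.comp (hnet.measurable_pos _)) (hnet.measurable_fading _).ennreal_ofReal
        hind).le.trans ?_
      refine mul_le_mul' le_rfl ?_
      exact lintegral_fading_le hnet.measurable_fading hnet.fading_law _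
  filter_upwards [ae_lt_top (Measurable.tsum fun i => (hw.comp (hnet.measurable_pos (i + 1))).mul
    (hnet.measurable_fading (i + 1)).ennreal_ofReal) hfin,
    ae_fading_pos hnet.measurable_fading hnet.fading_law] with ω h1 h2
  refine (summable_nat_add_iff 1).1 ((ENNReal.summable_toReal h1.ne).congr fun i => ?_)
  change (ENNReal.ofReal (pathLoss p.alpha (x (i + 1) ω)) *
    ENNReal.ofReal (h (i + 1) ω)).toReal = _
  rw [ENNReal.toReal_mul, ENNReal.toReal_ofReal (pathLoss_nonneg _ _),
    ENNReal.toReal_ofReal (h2 _).le, rxPower_eq]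

theorem ae_interference_pos (hnet : IsBipolarNetwork μ p x h) (hp : p.Valid) :
    ∀ᵐ ω ∂μ, ∀ n, 0 < interference p x h n ω := by
  filter_upwards [hnet.ae_summable_rxPower hp,
    ae_fading_pos hnet.measurable_fading hnet.fading_law] with ω h1 h2 n
  have hpos : ∀ i, 0 < rxPower p x h i ω := fun i => by
    have := h2 i
    unfold rxPower
    positivity
  have h3 : Summable fun i => rxPower p x h (n + 1 + i) ω := by
    simpa [add_comm] using (summable_nat_add_iff (n + 1)).2 h1
  exact h3.tsum_pos (fun i => (hpos _).le) 0 (hpos _)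

theorem measure_useful_eq (hnet : IsBipolarNetwork μ p x h) (hp : p.Valid) (hv : 0 < v) (n : ℕ) :
    μ.real (successEvent p v (attemptTerms p x h) (.useful n)) =
      p.noiseFactor v (p.theta * p.tau) * ∫ ω, Real.exp (-∑' i : ℕ,
        if n ≤ i then Real.log (1 + p.theta * p.tau * pathLoss p.alpha (x (i + 1) ω)) else 0) ∂μ := by
  have hτ := hp.tau_pos
  have hθ := hp.theta_pos
  set a := p.theta * p.tau with ha
  have ha0 : 0 ≤ a := by positivity
  -- The weights vanish for every `i ≤ n`: the cancelled interferers drop out, and so does index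
  -- `0`, the useful signal playing the role of `h m`.
  let c : ℕ → (ℕ → Plane) → ℝ := fun i e => if n < i then a * pathLoss p.alpha (e i) else 0
  have hc0 : ∀ i e, 0 ≤ c i e := fun i e => by
    have := pathLoss_nonneg p.alpha (e i)
    simp only [c]
    split_ifs <;> positivity
  have hcs : ∀ᵐ ω ∂μ, Summable fun i => c i fun i => x i ω := by
    filter_upwards [hnet.ae_summable_pathLoss hp] with ω hω
    refine ((hω.mul_left a).indicator {i | n < i}).congr fun i => ?_
    simp [Set.indicator, c]
  have hx : Measurable fun ω i => x i ω := measurable_pi_lambda _ hnet.measurable_pos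
  have hmain := measure_add_tsum_le_fading_of_indepFun (m := 0) (c := c)
    (b := fun _ => a * p.noise v) hx hnet.measurable_fading hnet.fading_law hnet.fading_indep
    hnet.fading_indep_pos (fun i => by
      simp only [c]
      split_ifs
      · exact ((measurable_pathLoss p.alpha).comp (measurable_pi_apply i)).const_mul a
      · exact measurable_const) measurable_const hc0 hcs (fun e => by simp [c])
    (fun _ => mul_nonneg ha0 (hp.noise_nonneg hv))
  have hset : successEvent p v (attemptTerms p x h) (.useful n) =ᵐ[μ]
      {ω | a * p.noise v + ∑' i, c i (fun i => x i ω) * h i ω ≤ h 0 ω} := by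
    filter_upwards [hnet.ae_summable_rxPower hp, hnet.ae_interference_pos hp,
      hnet.ae_rxPower_zero] with ω h1 h2 h3
    refine propext ?_
    refine (SysParams.le_sinr_iff hp hv (t := attemptTerms p x h (.useful n) ω) (h2 n)).trans ?_
    change p.theta * (p.noise v + interference p x h n ω) ≤ rxPower p x h 0 ω ↔
      a * p.noise v + ∑' i, c i (fun i => x i ω) * h i ω ≤ h 0 ω
    have h4 : ∑' i, c i (fun i => x i ω) * h i ω = a * interference p x h n ω := by
      rw [interference, ← tsum_ite_lt h1 n, ← tsum_mul_left]
      refine tsum_congr fun i => ?_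
      simp only [c, rxPower_eq]
      split_ifs <;> ring
    rw [h4, h3, ← mul_add, ha, mul_comm p.tau⁻¹, ← div_eq_mul_inv, le_div_iff₀ hτ]
    ring_nf
  rw [measureReal_def, measure_congr hset, hmain, ENNReal.toReal_ofReal
    (integral_nonneg fun ω => by positivity), integral_const_mul, SysParams.noiseFactor_eq hp hv]
  congr 1
  refine integral_congr_ae ?_
  filter_upwards [hcs] with ω hω
  have h5 := summable_log_one_add (fun i => hc0 i fun i => x i ω) hω
  rw [h5.tsum_eq_zero_add]
  congr 2
  have h6 : Real.log (1 + c 0 fun i => x i ω) = 0 := by simp [c]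
  rw [h6, zero_add]
  refine tsum_congr fun i => ?_
  simp only [c, Nat.lt_succ_iff]
  split_ifs <;> simp

theorem measure_interferer_eq (hnet : IsBipolarNetwork μ p x h) (hp : p.Valid) (hv : 0 < v)
    (n : ℕ+) :
    μ.real (successEvent p v (attemptTerms p x h) (.interferer n)) =
      ∫ ω, p.noiseFactor v (p.theta * (1 + ‖x n ω‖ ^ p.alpha)) *
        (1 + p.theta * (1 + ‖x n ω‖ ^ p.alpha) * p.tau⁻¹)⁻¹ * Real.exp (-∑' i : ℕ,
        if (n : ℕ) ≤ i then Real.log (1 + p.theta * (1 + ‖x n ω‖ ^ p.alpha) *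
          pathLoss p.alpha (x (i + 1) ω)) else 0) ∂μ := by
  have hτ := hp.tau_pos
  have hθ := hp.theta_pos
  have hn : (n : ℕ) ≠ 0 := n.ne_zero
  let a : Plane → ℝ := fun y => p.theta * (1 + ‖y‖ ^ p.alpha)
  have ha0 : ∀ y, 0 ≤ a y := fun y => by positivity
  have ham : Measurable a := by fun_prop
  -- Index `0` now carries the weight of the useful signal as interference, with the constant `τ⁻¹`
  -- in place of the random path loss of `x 0`. Indices `1, …, n` have weight zero.
  let c : ℕ → (ℕ → Plane) → ℝ := fun i e => a (e n) *
    (if n < i then pathLoss p.alpha (e i) else if i = 0 then p.tau⁻¹ else 0)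
  have hc0 : ∀ i e, 0 ≤ c i e := fun i e => by
    have := pathLoss_nonneg p.alpha (e i)
    have := ha0 (e n)
    simp only [c]
    split_ifs <;> positivity
  have hcs : ∀ᵐ ω ∂μ, Summable fun i => c i fun i => x i ω := by
    filter_upwards [hnet.ae_summable_pathLoss hp] with ω hω
    refine Summable.mul_left _ ?_
    refine (summable_nat_add_iff 1).1 ((((summable_nat_add_iff 1).2 hω).indicator
      {i | (n : ℕ) < i + 1}).congr fun i => ?_)
    simp [Set.indicator]
  have hx : Measurable fun ω i => x i ω := measurable_pi_lambda _ hnet.measurable_pos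
  have hmain := measure_add_tsum_le_fading_of_indepFun (m := n) (c := c)
    (b := fun e => a (e n) * p.noise v) hx hnet.measurable_fading hnet.fading_law
    hnet.fading_indep hnet.fading_indep_pos (fun i => by
      refine (ham.comp (measurable_pi_apply (n : ℕ))).mul ?_
      split_ifs
      · exact (measurable_pathLoss p.alpha).comp (measurable_pi_apply i)
      · exact measurable_const
      · exact measurable_const) ((ham.comp (measurable_pi_apply (n : ℕ))).mul_const _) hc0 hcs
    (fun e => by simp [c]) (fun _ => mul_nonneg (ha0 _) (hp.noise_nonneg hv))
  have hset : successEvent p v (attemptTerms p x h) (.interferer n) =ᵐ[μ]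
      {ω | a (x n ω) * p.noise v + ∑' i, c i (fun i => x i ω) * h i ω ≤ h n ω} := by
    filter_upwards [hnet.ae_summable_rxPower hp, hnet.ae_interference_pos hp,
      hnet.ae_rxPower_zero, ae_fading_pos hnet.measurable_fading hnet.fading_law]
      with ω h1 h2 h3 h7
    have h8 : 0 < interference p x h n ω + rxPower p x h 0 ω := by
      have := h2 n
      have := h7 0
      rw [h3]
      positivity
    refine propext ?_
    refine (SysParams.le_sinr_iff hp hv (t := attemptTerms p x h (.interferer n) ω) h8).trans ?_
    change p.theta * (p.noise v + (interference p x h n ω + rxPower p x h 0 ω)) ≤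
      rxPower p x h n ω ↔
      a (x n ω) * p.noise v + ∑' i, c i (fun i => x i ω) * h i ω ≤ h n ω
    have h4 : ∑' i, c i (fun i => x i ω) * h i ω =
        a (x n ω) * (interference p x h n ω + rxPower p x h 0 ω) := by
      have h9 : Summable fun i => if (n : ℕ) < i then rxPower p x h i ω else 0 :=
        (h1.indicator {i | (n : ℕ) < i}).congr fun i => by simp [Set.indicator]
      have h10 : HasSum (fun i => if i = 0 then rxPower p x h 0 ω else 0) (rxPower p x h 0 ω) :=
        hasSum_ite_eq 0 _
      rw [interference, ← tsum_ite_lt h1 n]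
      conv_rhs => rw [← h10.tsum_eq]
      rw [← h9.tsum_add h10.summable, ← tsum_mul_left]
      refine tsum_congr fun i => ?_
      by_cases hi : i = 0
      · subst hi
        simp only [c, not_lt_zero, if_false, if_true, h3]
        ring
      · simp only [c, hi, if_false, rxPower_eq]
        split_ifs <;> ring
    have h5 : (0 : ℝ) < 1 + ‖x n ω‖ ^ p.alpha := by positivity
    rw [h4, ← mul_add, show rxPower p x h n ω = h n ω / (1 + ‖x n ω‖ ^ p.alpha) from rfl,
      le_div_iff₀ h5]
    simp only [a]
    ring_nf
  rw [measureReal_def, measure_congr hset, hmain, ENNReal.toReal_ofReal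
    (integral_nonneg fun ω => by positivity)]
  refine integral_congr_ae ?_
  filter_upwards [hcs] with ω hω
  have h5 := summable_log_one_add (fun i => hc0 i fun i => x i ω) hω
  -- The term of index `0` is split off because `x 0` is not a point of the Poisson process; it
  -- yields the factor $(1+\theta\xi\tau^{-1})^{-1}$.
  rw [h5.tsum_eq_zero_add, SysParams.noiseFactor_eq hp hv]
  have h6 : (1 + c 0 fun i => x i ω) = 1 + p.theta * (1 + ‖x n ω‖ ^ p.alpha) * p.tau⁻¹ := by
    simp [c, a]
  have h7 : 0 < 1 + p.theta * (1 + ‖x n ω‖ ^ p.alpha) * p.tau⁻¹ := by positivity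
  rw [h6, neg_add, Real.exp_add, Real.exp_neg (Real.log _), Real.exp_log h7, ← mul_assoc]
  congr 3
  refine tsum_congr fun i => ?_
  simp only [c, a, Nat.lt_succ_iff, Nat.succ_ne_zero, if_false]
  split_ifs <;> simp

end IsBipolarNetwork

theorem continuous_laplaceWeight {lam : ℝ} {w : Plane → ℝ} (hw : Measurable w)
    (hw0 : ∀ y, 0 ≤ w y) (hwi : Integrable w) {s : ℝ → ℝ} (hs : Continuous s)
    (hs0 : ∀ r, 0 ≤ s r) : Continuous fun r => laplaceWeight lam w (s r) r := by
  rw [continuous_iff_seqContinuous]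
  intro u r hu
  exact tendsto_laplaceWeight hw hw0 hwi ((hs.tendsto r).comp hu) (fun k => hs0 _) hu

namespace IsBipolarNetwork

variable [IsProbabilityMeasure μ]

theorem integral_beyond_eq (hnet : IsBipolarNetwork μ p x h) (hp : p.Valid) {n : ℕ} (hn : 1 ≤ n)
    {s φ : ℝ → ℝ} (hs : Continuous s) (hφ : Continuous φ) (hs0 : ∀ r, 0 ≤ s r)
    (hφ1 : ∀ r, |φ r| ≤ 1) :
    ∫ ω, φ ‖x n ω‖ * Real.exp (-∑' i : ℕ, if n ≤ i then
        Real.log (1 + s ‖x n ω‖ * pathLoss p.alpha (x (i + 1) ω)) else 0) ∂μ =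
      ∫ r in Set.Ioi 0, p.distDensity r n * (φ r * p.interfFactor (s r) r) := by
  have hw := measurable_pathLoss p.alpha
  have hw0 := pathLoss_nonneg p.alpha
  have hwi := integrable_pathLoss hp.two_lt_alpha
  rw [integral_mul_exp_neg_tsum_beyond hnet.poisson hp.lam_pos.le hnet.measurable_pos hnet.ordered
    hn hw hw0 hwi hs hφ (fun r _ => hs0 r) (fun r _ => hφ1 r)]
  obtain ⟨m, rfl⟩ := Nat.exists_eq_add_of_le' hn
  rw [integral_comp_norm_eq hp.lam_pos hnet.poisson hnet.measurable_pos hnet.ordered m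
    (G := fun r => φ r * laplaceWeight p.lam (pathLoss p.alpha) (s r) r)
    (hφ.mul (continuous_laplaceWeight hw hw0 hwi hs hs0)).measurable]
  refine setIntegral_congr_fun measurableSet_Ioi fun r hr => ?_
  rw [laplaceWeight_pathLoss_eq_interfFactor hp.two_lt_alpha (hs0 r) hr]

theorem measure_useful_eq_PiC (hnet : IsBipolarNetwork μ p x h) (hp : p.Valid) (hv : 0 < v)
    (n : ℕ) :
    μ.real (successEvent p v (attemptTerms p x h) (.useful n)) = p.PiC v n := by
  have ha0 : 0 ≤ p.theta * p.tau := mul_nonneg hp.theta_pos.le hp.tau_pos.le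
  rw [hnet.measure_useful_eq hp hv, SysParams.PiC]
  split_ifs with hn
  · subst hn
    rw [SysParams.PiNC, ← laplaceWeight_pathLoss_zero p.lam hp.two_lt_alpha ha0]
    congr 1
    have hw := measurable_pathLoss p.alpha
    have hw0 := pathLoss_nonneg p.alpha
    have hwi := integrable_pathLoss hp.two_lt_alpha
    -- With `B` empty and `ψ = 1` this is the plain Laplace functional: radius `0` removes no point.
    have h1 := hnet.poisson.integral_mul_exp_neg_tsum hp.lam_pos.le hnet.measurable_pos
      (measurable_logWeight hw (p.theta * p.tau) 0) (logWeight_nonneg hw0 ha0)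
      (integrable_logWeight hw hw0 hwi ha0) MeasurableSet.empty (by simp) (by simp)
      (ψ := fun _ => 1) (by simp)
    simpa [laplaceWeight, logWeight] using h1
  · congr 1
    have h1 := hnet.integral_beyond_eq hp (Nat.one_le_iff_ne_zero.2 hn) (φ := fun _ => 1)
      (s := fun _ => p.theta * p.tau) continuous_const continuous_const (fun _ => ha0) (by simp)
    simpa using h1

theorem measure_interferer_eq_PiD (hnet : IsBipolarNetwork μ p x h) (hp : p.Valid) (hv : 0 < v)
    (n : ℕ+) :
    μ.real (successEvent p v (attemptTerms p x h) (.interferer n)) = p.PiD v n := by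
  have hτ := hp.tau_pos
  have hθ := hp.theta_pos
  have hN := hp.noise_nonneg hv
  have hα : 0 ≤ p.alpha := by linarith [hp.two_lt_alpha]
  -- The absolute value makes `s` nonnegative on the whole line; it is invisible at `r = ‖x n‖`.
  let s : ℝ → ℝ := fun r => p.theta * (1 + |r| ^ p.alpha)
  have hs0 : ∀ r, 0 ≤ s r := fun r => by positivity
  have hs : Continuous s := by
    have : Continuous fun r : ℝ => |r| ^ p.alpha :=
      (Real.continuous_rpow_const hα).comp continuous_abs
    fun_prop
  let φ : ℝ → ℝ := fun r => Real.exp (-(s r * p.noise v)) * (1 + s r * p.tau⁻¹)⁻¹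
  have hpos : ∀ r, 1 ≤ 1 + s r * p.tau⁻¹ := fun r => by
    have := hs0 r
    have : 0 ≤ s r * p.tau⁻¹ := by positivity
    linarith
  have hφ : Continuous φ := by
    refine Continuous.mul (by fun_prop) (Continuous.inv₀ (by fun_prop) fun r => ?_)
    linarith [hpos r]
  have hφ1 : ∀ r, |φ r| ≤ 1 := fun r => by
    have h1 := hpos r
    rw [abs_of_nonneg (by positivity)]
    refine mul_le_one₀ ?_ (by positivity) (inv_le_one_of_one_le₀ h1)
    rw [Real.exp_le_one_iff, neg_nonpos]
    exact mul_nonneg (hs0 r) hN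
  rw [hnet.measure_interferer_eq hp hv, SysParams.PiD]
  have h1 := hnet.integral_beyond_eq hp (n := n) n.pos hs hφ hs0 hφ1
  simp only [φ, s, abs_norm] at h1
  simp_rw [SysParams.noiseFactor_eq hp hv]
  rw [h1]
  refine setIntegral_congr_fun measurableSet_Ioi fun r hr => ?_
  rw [abs_of_pos hr]
  ring

end IsBipolarNetwork

end Network

/-! ### Successive cancellation under the independence assumption. -/

section Cancellation

variable {Ω : Type*} [MeasurableSpace Ω] {ν : Measure Ω}
  {p : SysParams} {v : ℝ} {T : Attempt → Ω → ℝ × ℝ}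

theorem measurable_sinr (p : SysParams) (v : ℝ) : Measurable (sinr p v) := by
  unfold sinr
  fun_prop

theorem measurableSet_le_sinr (p : SysParams) (v : ℝ) :
    MeasurableSet {t | p.theta ≤ sinr p v t} :=
  measurableSet_le measurable_const (measurable_sinr p v)

theorem measureReal_sicState [IsProbabilityMeasure ν] (hT : ∀ a, AEMeasurable (T a) ν)
    (hi : iIndepFun T ν) {c d : ℕ → ℝ}
    (hc : ∀ n, ν.real (successEvent p v T (.useful n)) = c n)
    (hd : ∀ n : ℕ+, ν.real (successEvent p v T (.interferer n)) = d n) (i : ℕ) :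
    ν.real (sicState p v T i) =
      (∏ j ∈ Finset.range i, (1 - c j)) * (∏ j ∈ Finset.Icc 1 i, d j) * c i := by
  let A : Set (ℝ × ℝ) := {t | p.theta ≤ sinr p v t}
  have hA : MeasurableSet A := measurableSet_le_sinr p v
  -- Left indices stand for decodings of the useful signal, right indices for the interferers. The
  -- right index `j` means interferer `j + 1`, since interferers are numbered from one.
  let g : ℕ ⊕ ℕ → Attempt := Sum.elim .useful fun j => .interferer j.succPNat
  have hg : Function.Injective g := by
    rintro (a | a) (b | b) hab
    · exact congrArg _ (Attempt.useful.inj hab)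
    · cases hab
    · cases hab
    · exact congrArg _ (Nat.succPNat_injective (Attempt.interferer.inj hab))
  -- The useful signal must fail at `j < i` and succeed at `j = i`; every interferer must be
  -- decoded.
  let S : ℕ ⊕ ℕ → Set (ℝ × ℝ) := Sum.elim (fun j => if j < i then Aᶜ else A) fun _ => A
  have hS : ∀ q, MeasurableSet (S q) := by
    rintro (j | j)
    · change MeasurableSet (if j < i then Aᶜ else A)
      split_ifs
      exacts [hA.compl, hA]
    · exact hA
  let F := (Finset.range (i + 1)).disjSum (Finset.range i)
  have hset : sicState p v T i = ⋂ q ∈ F, T (g q) ⁻¹' S q := by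
    ext ω
    simp only [Set.mem_iInter, F, Finset.mem_disjSum, Set.mem_preimage]
    constructor
    · rintro ⟨h1, h2, h3⟩ q (⟨j, hj, rfl⟩ | ⟨j, hj, rfl⟩)
      · change T (.useful j) ω ∈ if j < i then Aᶜ else A
        split_ifs with hji
        · exact h1 j hji
        · rw [show j = i by have := Finset.mem_range.1 hj; omega]
          exact h3
      · exact h2 j.succPNat (Finset.mem_range.1 hj)
    · intro hq
      refine ⟨fun j hj => ?_, fun j hj => ?_, ?_⟩
      · have h1 : T (.useful j) ω ∈ if j < i then Aᶜ else A :=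
          hq (.inl j) (Or.inl ⟨j, Finset.mem_range.2 (by omega), rfl⟩)
        rw [if_pos hj] at h1
        exact h1
      · have hpos := j.pos
        have h1 : T (.interferer (j : ℕ).pred.succPNat) ω ∈ A :=
          hq (.inr (j : ℕ).pred) (Or.inr ⟨_, Finset.mem_range.2 (by
            rw [Nat.pred_eq_sub_one]; omega), rfl⟩)
        have h2 : (j : ℕ).pred.succPNat = j := PNat.eq (by
          rw [Nat.succPNat_coe, Nat.succ_pred_eq_of_pos hpos])
        rw [h2] at h1
        exact h1
      · have h1 : T (.useful i) ω ∈ if i < i then Aᶜ else A :=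
          hq (.inl i) (Or.inl ⟨i, Finset.mem_range.2 (by omega), rfl⟩)
        rw [if_neg (lt_irrefl i)] at h1
        exact h1
  have hprod := (hi.precomp hg).measure_inter_preimage_eq_mul F (sets := S) fun q _ => hS q
  have hnull : ∀ a, NullMeasurableSet (successEvent p v T a) ν := fun a =>
    (hT a).nullMeasurableSet_preimage hA
  rw [measureReal_def, hset, hprod, ENNReal.toReal_prod, Finset.prod_disjSum,
    Finset.prod_range_succ, mul_right_comm]
  congr 1
  · congr 1
    · refine Finset.prod_congr rfl fun j hj => ?_
      rw [← hc j, ← probReal_compl_eq_one_sub₀ (hnull _)]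
      simp only [g, S, Sum.elim_inl, if_pos (Finset.mem_range.1 hj)]
      rfl
    · have h1 : ∏ j ∈ Finset.Icc 1 i, d j = ∏ j ∈ Finset.range i, d (j + 1) := by
        rw [← Finset.Ico_add_one_right_eq_Icc, Finset.prod_Ico_eq_prod_range]
        simp [add_comm]
      rw [h1]
      refine Finset.prod_congr rfl fun j _ => ?_
      exact hd j.succPNat
  · rw [← hc i]
    simp only [g, S, Sum.elim_inl, lt_irrefl, if_false]
    rfl

theorem measureReal_sicCoverage [IsProbabilityMeasure ν] (hT : ∀ a, AEMeasurable (T a) ν)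
    (hi : iIndepFun T ν) {c d : ℕ → ℝ}
    (hc : ∀ n, ν.real (successEvent p v T (.useful n)) = c n)
    (hd : ∀ n : ℕ+, ν.real (successEvent p v T (.interferer n)) = d n) (n : ℕ) :
    ν.real (sicCoverage p v T n) = c 0 + ∑ i ∈ Finset.Icc 1 n,
      (∏ j ∈ Finset.range i, (1 - c j)) * (∏ j ∈ Finset.Icc 1 i, d j) * c i := by
  have hnull : ∀ a, NullMeasurableSet (successEvent p v T a) ν := fun a =>
    (hT a).nullMeasurableSet_preimage (measurableSet_le_sinr p v)
  have hstate : ∀ i, NullMeasurableSet (sicState p v T i) ν := by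
    intro i
    have : sicState p v T i = (⋂ j : ℕ, ⋂ _ : j < i, (successEvent p v T (.useful j))ᶜ) ∩
        ((⋂ j : ℕ+, ⋂ _ : (j : ℕ) ≤ i, successEvent p v T (.interferer j)) ∩
          successEvent p v T (.useful i)) := by
      ext ω; simp [sicState]
    rw [this]
    exact (NullMeasurableSet.iInter fun j => .iInter fun _ => (hnull _).compl).inter
      ((NullMeasurableSet.iInter fun j => .iInter fun _ => hnull _).inter (hnull _))
  -- For `i < j`, the useful signal is decoded after `i` cancellations in state `i` but not in state
  -- `j`.
  have hdisj : Pairwise (Function.onFun Disjoint (sicState p v T)) := by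
    refine (pairwise_disjoint_on _).2 fun i j hij => Set.disjoint_left.2 fun ω h1 h2 => ?_
    exact h2.1 i hij h1.2.2
  rw [sicCoverage, measureReal_biUnion_finset₀ (fun i _ j _ hij => (hdisj hij).aedisjoint)
    (fun i _ => hstate i)]
  simp_rw [measureReal_sicState hT hi hc hd]
  rw [Finset.sum_range_eq_add_Ico _ (Nat.succ_pos n)]
  simp [Finset.Ico_add_one_right_eq_Icc]

end Cancellation

theorem theorem1 (p : SysParams) (hp : p.Valid) (v : ℝ) (hv0 : 0 < v) (hv1 : v ≤ 1)
    {Ω : Type*} [MeasurableSpace Ω] (μ : Measure Ω) [IsProbabilityMeasure μ]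
    (x : ℕ → Ω → Plane) (h : ℕ → Ω → ℝ) (hnet : IsBipolarNetwork μ p x h) :
    (∀ᵐ ω ∂μ, Summable fun i => rxPower p x h i ω) ∧
    (∀ n : ℕ,
      μ.real (successEvent p v (attemptTerms p x h) (.useful n)) = p.PiC v n) ∧
    (∀ n : ℕ+,
      μ.real (successEvent p v (attemptTerms p x h) (.interferer n)) = p.PiD v n) ∧
    (∀ {Ω' : Type*} [MeasurableSpace Ω'] (ν : Measure Ω') [IsProbabilityMeasure ν]
      (T : Attempt → Ω' → ℝ × ℝ),
      (∀ a, IdentDistrib (T a) (attemptTerms p x h a) ν μ) →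
      iIndepFun T ν →
      ∀ n : ℕ,
        ν.real (sicCoverage p v T n) = p.PiNC v +
          ∑ i ∈ Finset.Icc 1 n,
            (∏ j ∈ Finset.range i, (1 - p.PiC v j)) *
              (∏ j ∈ Finset.Icc 1 i, p.PiD v j) * p.PiC v i) := by
  have hC := hnet.measure_useful_eq_PiC hp hv0
  have hD := hnet.measure_interferer_eq_PiD hp hv0
  refine ⟨hnet.ae_summable_rxPower hp, hC, hD, fun ν _ T hid hind n => ?_⟩
  -- Only the law of each pair separately matters here; the joint law of the replaced pairs is
  -- supplied by their independence.
  have hlaw : ∀ a, ν.real (successEvent p v T a) =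
      μ.real (successEvent p v (attemptTerms p x h) a) := fun a =>
    congrArg ENNReal.toReal ((hid a).measure_mem_eq (measurableSet_le_sinr p v))
  have h0 : p.PiNC v = p.PiC v 0 := (if_pos rfl).symm
  rw [h0]
  exact measureReal_sicCoverage (fun a => (hid a).aemeasurable_fst) hind
    (fun j => (hlaw _).trans (hC j)) (fun j => (hlaw _).trans (hD j)) n
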